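/- Let $\mathcal M\subset\mathbb R^3$ be a smooth embedded surface homeomorphic to $\mathbb S^2$, with area measure $\mathcal H^2$, tangential gradient $\nabla$ and Laplace–Beltrami operator $\Delta$, and let $H^1(\mathcal M)$ be the completion of the smooth functions on $\mathcal M$ in the norm $\left(\int_{\mathcal M}(V^2+|\nabla V|^2)\,d\mathcal H^2\right)^{1/2}$. Let $H\in C^1(\mathcal M)$ (the normal component of the magnetic field), and let $f={*F}\in C(\mathcal M)\cap H^1(\mathcal M)$ satisfy $\Delta f=H$ in the weak sense, that is, $\int_{\mathcal M}\nabla f\cdot\nabla\varphi\,d\mathcal H^2=-\int_{\mathcal M}H\varphi\,d\mathcal H^2$ for all smooth $\varphi$. Put $$\beta_c:=\max_{\mathcal M} f-\min_{\mathcal M} f .$$ For $0<\beta\le\beta_c$ let $V_\beta$ be a solution (it is unique as an element of $H^1(\mathcal M)$) of the two-sided obstacle problem $$\min\left\{\int_{\mathcal M}\left(|\nabla V|^2+2HV\right)d\mathcal H^2\;:\;V\in H^1(\mathcal M),\ |V|\le \beta/2\ \text{a.e.}\right\},$$ and let $$SC_\beta:=\{x\in\mathcal M:\ |V_\beta(x)|<\beta/2\}$$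 be the superconductivity region. Here $|V_\beta(x)|<\beta/2$ is read without choosing a representative: there are $c<\beta/2$ and an open set $O\ni x$ such that $|V_\beta|\le c$ almost everywhere in $O$; for the continuous representative of $V_\beta$ this is the pointwise inequality. Then for all $0<\beta_1<\beta_2\le\beta_c$, $$SC_{\beta_1}\subset SC_{\beta_2}\qquad\text{and}\qquad |V_{\beta_1}-V_{\beta_2}|\le\frac{\beta_2-\beta_1}{2}\quad\text{a.e. in }\mathcal M .$$ -/

import Mathlib

open MeasureTheory Set Filter Topology
open scoped ContDiff

/-- A regular (smooth, embedded) surface in `ℝ³`: every point of `S` has a relatively open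
neighbourhood in `S` which is the image of a smooth parametrization, that is, of a smooth immersion
of an open subset of the plane which is a homeomorphism onto its image. -/
def IsRegularSurface (S : Set (EuclideanSpace ℝ (Fin 3))) : Prop :=
  ∀ p ∈ S, ∃ (U : Set (EuclideanSpace ℝ (Fin 2))) (W : Set (EuclideanSpace ℝ (Fin 3)))
    (ψ : EuclideanSpace ℝ (Fin 2) → EuclideanSpace ℝ (Fin 3)),
    IsOpen U ∧ IsOpen W ∧ p ∈ W ∧ ContDiffOn ℝ ∞ ψ U ∧
    (∀ u ∈ U, Function.Injective (fderiv ℝ ψ u)) ∧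
    IsEmbedding (U.domRestrict ψ) ∧ ψ '' U = W ∩ S

/-- The tangent plane of `S` at `p`, as a linear subspace of `ℝ³`: the span of all limits of
rescaled secants `c (q - p)`, `q ∈ S`, `q → p`. -/
noncomputable def surfaceTangent (S : Set (EuclideanSpace ℝ (Fin 3)))
    (p : EuclideanSpace ℝ (Fin 3)) : Submodule ℝ (EuclideanSpace ℝ (Fin 3)) :=
  Submodule.span ℝ (tangentConeAt ℝ S p)

/-- The tangential gradient `∇_S φ` at `p` of (the restriction to `S` of) a function `φ` on `ℝ³`:
the orthogonal projection of `∇ φ (p)` to the tangent plane. -/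
noncomputable def surfaceGradient (S : Set (EuclideanSpace ℝ (Fin 3)))
    (φ : EuclideanSpace ℝ (Fin 3) → ℝ) (p : EuclideanSpace ℝ (Fin 3)) :
    EuclideanSpace ℝ (Fin 3) :=
  (surfaceTangent S p).starProjection (gradient φ p)

/-- The area measure on `S`: two-dimensional Hausdorff measure, normalized so that it is
Lebesgue measure on a plane. -/
noncomputable def surfaceArea (S : Set (EuclideanSpace ℝ (Fin 3))) : Measure S :=
  Measure.euclideanHausdorffMeasure 2

/-- `V` belongs to the Sobolev space `H¹(S)` and `G` is its (tangential) gradient. Here `H¹(S)` is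
the completion of the smooth functions on `S` in the norm `(‖V‖² + ‖∇V‖²)^(1/2)`, realized
inside `L²`: there are smooth functions converging to `V` in `L²(S)` whose gradients converge to
`G` in `L²(S)`. -/
def HasSobolevGradient (S : Set (EuclideanSpace ℝ (Fin 3))) (V : S → ℝ)
    (G : S → EuclideanSpace ℝ (Fin 3)) : Prop :=
  MemLp V 2 (surfaceArea S) ∧ MemLp G 2 (surfaceArea S) ∧
  ∃ φ : ℕ → EuclideanSpace ℝ (Fin 3) → ℝ, (∀ n, ContDiff ℝ ∞ (φ n)) ∧
    Tendsto (fun n => eLpNorm (fun x : S => φ n x - V x) 2 (surfaceArea S)) atTop (𝓝 0) ∧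
    Tendsto (fun n => eLpNorm (fun x : S => surfaceGradient S (φ n) x - G x) 2 (surfaceArea S))
      atTop (𝓝 0)

/-- `H` is a `C¹` function on `S`, i.e. the restriction of a `C¹` function on `ℝ³`. -/
def IsSurfaceC1 (S : Set (EuclideanSpace ℝ (Fin 3))) (H : S → ℝ) : Prop :=
  ∃ h : EuclideanSpace ℝ (Fin 3) → ℝ, ContDiff ℝ 1 h ∧ ∀ x : S, h x = H x

/-- `f ∈ H¹(S)` and `Δ f = H` on `S`, where `Δ` is the Laplace-Beltrami operator in its weak form:
`∫ ∇f · ∇φ = - ∫ H φ` for all smooth `φ`. -/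
def HasSurfaceLaplacian (S : Set (EuclideanSpace ℝ (Fin 3))) (f H : S → ℝ) : Prop :=
  ∃ G : S → EuclideanSpace ℝ (Fin 3), HasSobolevGradient S f G ∧
    ∀ φ : EuclideanSpace ℝ (Fin 3) → ℝ, ContDiff ℝ ∞ φ →
      ∫ x : S, inner ℝ (G x) (surfaceGradient S φ x) ∂(surfaceArea S)
        = - ∫ x : S, H x * φ x ∂(surfaceArea S)

/-- The energy `∫ (|∇V|² + 2 H V)`, where `G = ∇V`. -/
noncomputable def obstacleEnergy (S : Set (EuclideanSpace ℝ (Fin 3))) (H V : S → ℝ)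
    (G : S → EuclideanSpace ℝ (Fin 3)) : ℝ :=
  ∫ x : S, (‖G x‖ ^ 2 + 2 * H x * V x) ∂(surfaceArea S)

/-- `V` solves the two-sided obstacle problem: it minimizes `∫ (|∇W|² + 2 H W)` among all
`W ∈ H¹(S)` with `|W| ≤ β / 2` almost everywhere. -/
def IsObstacleSolution (S : Set (EuclideanSpace ℝ (Fin 3))) (H : S → ℝ) (β : ℝ)
    (V : S → ℝ) : Prop :=
  ∃ G : S → EuclideanSpace ℝ (Fin 3), HasSobolevGradient S V G ∧
    (∀ᵐ x ∂(surfaceArea S), |V x| ≤ β / 2) ∧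
    ∀ (W : S → ℝ) (K : S → EuclideanSpace ℝ (Fin 3)), HasSobolevGradient S W K →
      (∀ᵐ x ∂(surfaceArea S), |W x| ≤ β / 2) →
      obstacleEnergy S H V G ≤ obstacleEnergy S H W K

/-- The superconductivity region `{|V| < β / 2}` of an element `V` of `H¹(S)`. As `V` is
only defined up to null sets, `|V| < β / 2` at `x` means that `|V|` is essentially bounded by some
constant smaller than `β / 2` near `x`; for the continuous representative of `V` this is
literally `|V x| < β / 2`, see `superconductivityRegion_eq`. -/
def superconductivityRegion (S : Set (EuclideanSpace ℝ (Fin 3))) (β : ℝ) (V : S → ℝ) : Set S :=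
  {x | ∃ c < β / 2, ∃ O : Set S, IsOpen O ∧ x ∈ O ∧
    ∀ᵐ y ∂(surfaceArea S), y ∈ O → |V y| ≤ c}

/-- Nonempty open subsets of a regular surface have positive area. -/
theorem surfaceArea_pos {S : Set (EuclideanSpace ℝ (Fin 3))} (hS : IsRegularSurface S)
    {O : Set S} (hO : IsOpen O) (hne : O.Nonempty) : surfaceArea S O ≠ 0 := by
  obtain ⟨⟨p, hp⟩, hpO⟩ := hne
  obtain ⟨U, W, ψ, hU, hW, hpW, hψ, hinj, hemb, himg⟩ := hS p hp
  obtain ⟨u, huU, hup⟩ : p ∈ ψ '' U := himg ▸ ⟨hpW, hp⟩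
  have hmem : ∀ v ∈ U, ψ v ∈ S := fun v hv => (himg ▸ mem_image_of_mem ψ hv : ψ v ∈ W ∩ S).2
  have hstr : HasStrictFDerivAt ψ (fderiv ℝ ψ u) u :=
    (hψ.contDiffAt (hU.mem_nhds huU)).hasStrictFDerivAt (by simp)
  obtain ⟨K, hK0, hK⟩ := (fderiv ℝ ψ u).toLinearMap.exists_antilipschitzWith
    (LinearMap.ker_eq_bot.2 (hinj u huU))
  obtain ⟨N, hN, hanti⟩ : ∃ N ∈ 𝓝 u, ApproximatesLinearOn ψ (fderiv ℝ ψ u) N (K⁻¹ / 2) :=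
    hstr.approximates_deriv_on_nhds (Or.inr (by positivity))
  have hlip : ∀ a ∈ N, ∀ b ∈ N, dist a b ≤ 2 * K * dist (ψ a) (ψ b) := by
    intro a ha b hb
    have h1 := hanti a ha b hb
    have h2 : ‖a - b‖ ≤ K * ‖fderiv ℝ ψ u (a - b)‖ := by
      simpa [dist_eq_norm] using hK.le_mul_dist (a - b) 0
    have h3 : ‖fderiv ℝ ψ u (a - b)‖ ≤ ‖ψ a - ψ b‖ + (K : ℝ)⁻¹ / 2 * ‖a - b‖ := by
      have := norm_sub_norm_le (fderiv ℝ ψ u (a - b)) (ψ a - ψ b)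
      rw [norm_sub_rev ((fderiv ℝ ψ u) (a - b))] at this
      have h1' : ‖ψ a - ψ b - (fderiv ℝ ψ u) (a - b)‖ ≤ (K : ℝ)⁻¹ / 2 * ‖a - b‖ := by
        simpa using h1
      linarith
    have hK0' : (0 : ℝ) < K := hK0
    have h4 : (K : ℝ) * ((K : ℝ)⁻¹ / 2 * ‖a - b‖) = ‖a - b‖ / 2 := by field_simp
    have h5 := mul_le_mul_of_nonneg_left h3 hK0'.le
    rw [mul_add, h4] at h5
    rw [dist_eq_norm, dist_eq_norm]
    linarith
  obtain ⟨O', hO', rfl⟩ := isOpen_induced_iff.1 hO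
  have hpre : ψ ⁻¹' O' ∈ 𝓝 u :=
    hstr.continuousAt.preimage_mem_nhds (hO'.mem_nhds (by simpa [hup] using hpO))
  have hT : N ∩ U ∩ ψ ⁻¹' O' ∈ 𝓝 u := inter_mem (inter_mem hN (hU.mem_nhds huU)) hpre
  set T := N ∩ U ∩ ψ ⁻¹' O' with hTdef
  let g : T → S := fun v => ⟨ψ v, hmem v v.2.1.2⟩
  have hg : AntilipschitzWith (2 * K) g := AntilipschitzWith.of_le_mul_dist fun a b => by
    simpa [Subtype.dist_eq, g] using hlip a a.2.1.1 b b.2.1.1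
  have h1 := hg.le_hausdorffMeasure_image (d := 2) (by norm_num) univ
  have h2 : (Measure.hausdorffMeasure 2 : Measure T) univ
      = (Measure.hausdorffMeasure 2 : Measure (EuclideanSpace ℝ (Fin 2))) T := by
    have := (isometry_subtype_coe (s := T)).hausdorffMeasure_image (d := 2) (by norm_num) univ
    simpa using this.symm
  have h3 : (Measure.hausdorffMeasure ((2 : ℕ) : ℝ) : Measure (EuclideanSpace ℝ (Fin 2))) T ≠ 0 :=
    (Measure.measure_pos_of_mem_nhds _ hT).ne'
  intro h0
  have h4 : (Measure.hausdorffMeasure 2 : Measure S) (Subtype.val ⁻¹' O') = 0 := by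
    have := Measure.addHaarScalarFactor_volume_hausdorffMeasure_ne_zero 2
    rw [surfaceArea, Measure.euclideanHausdorffMeasure_def, Measure.smul_apply] at h0
    simpa using (by simpa [ENNReal.smul_def] using h0 : _ ∨ _).resolve_left this
  have h5 : g '' univ ⊆ Subtype.val ⁻¹' O' := by
    rintro _ ⟨v, -, rfl⟩
    exact v.2.2
  rw [measure_mono_null h5 h4, mul_zero, h2] at h1
  exact h3 (by simpa using h1)

theorem superconductivityRegion_eq {S : Set (EuclideanSpace ℝ (Fin 3))} (hS : IsRegularSurface S)
    (β : ℝ) {V : S → ℝ} (hV : Continuous V) :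
    superconductivityRegion S β V = {x | |V x| < β / 2} := by
  ext x
  constructor
  · rintro ⟨c, hc, O, hO, hx, hae⟩
    refine lt_of_le_of_lt (not_lt.1 fun hlt => ?_) hc
    refine surfaceArea_pos hS (O := O ∩ {y | c < |V y|})
      (hO.inter (isOpen_lt continuous_const hV.abs)) ⟨x, hx, hlt⟩ ?_
    refine measure_mono_null ?_ (ae_iff.1 hae)
    rintro y ⟨hy, hcy⟩ h
    exact not_lt.2 (h hy) hcy
  · intro hx
    obtain ⟨c, h1, h2⟩ := exists_between (show |V x| < β / 2 from hx)
    exact ⟨c, h2, {y | |V y| < c}, isOpen_lt hV.abs continuous_const, h1,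
      Eventually.of_forall fun y hy => le_of_lt hy⟩

/-! Put δ = (β₂ - β₁)/2 and D = (V₂ - V₁ - δ)⁺. Then V₁ + D = max(V₁, V₂ - δ) is admissible for β₁
and V₂ - D = min(V₂, V₁ + δ) is admissible for β₂. On {D > 0} the two gradients are exchanged and
elsewhere nothing changes, so the total energy is the same. Minimality of V₂ therefore makes V₁ + D
a second minimizer for β₁, and convexity in the gradient gives ∇D = 0. Since the surface is
connected, D is a constant k.

If k > 0, then V₁ + k ≤ β₁/2. The function H has mean zero, because 1 is a test function in Δf = H,
so V₁ + k/2 has the same energy as V₁ and lies at distance k/2 from both obstacles. Hence V₁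
satisfies the unconstrained equation ΔV₁ = H, and V₁ - f is constant. The oscillation of f is then
at most β₁ - k < β₂, contradicting β₂ ≤ β_c. So k ≤ 0, that is, V₂ - V₁ ≤ δ
(`obstacleMinimizer_sub_le`). Changing the signs of V, H and f gives the other inequality, and the
inclusion of the regions follows at once.

The analytic input is that `HasSobolevGradient` is stable under positive parts
(`hasSobolevGradient_posPart`) and that zero gradient forces a constant (`exists_ae_eq_const`). The
latter rests on a Poincaré inequality in bi-Lipschitz charts. -/

/-- Euclidean space of dimension three. -/
abbrev Space : Type := EuclideanSpace ℝ (Fin 3)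

/-- The Euclidean plane. -/
abbrev Plane : Type := EuclideanSpace ℝ (Fin 2)

/-! ### Bi-Lipschitz charts and tangent planes. -/

/-- A bi-Lipschitz smooth parametrization of a relatively open piece of `S` by a disc. -/
structure SurfaceChart (S : Set Space) where
  /-- the centre of the disc -/
  center : Plane
  /-- the radius of the disc -/
  radius : ℝ
  radius_pos : 0 < radius
  /-- the parametrization as a map into space -/
  param : Plane → Space
  /-- the parametrization as a map into the surface -/
  lift : Plane → S
  /-- the Lipschitz constant of the parametrization -/
  lip : NNReal
  /-- the Lipschitz constant of the inverse of the parametrization -/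
  antilip : NNReal
  coe_lift : ∀ v ∈ Metric.ball center radius, (lift v : Space) = param v
  contDiffOn : ContDiffOn ℝ ∞ param (Metric.ball center radius)
  injective_fderiv : ∀ v ∈ Metric.ball center radius, Function.Injective (fderiv ℝ param v)
  lipschitzOn : LipschitzOnWith lip lift (Metric.ball center radius)
  edist_le : ∀ a ∈ Metric.ball center radius, ∀ b ∈ Metric.ball center radius,
    edist a b ≤ antilip * edist (lift a) (lift b)
  isOpen_image : IsOpen (lift '' Metric.ball center radius)

namespace SurfaceChart

variable {S : Set Space} (c : SurfaceChart S)

/-- The disc on which a chart is defined. -/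
def disc : Set Plane := Metric.ball c.center c.radius

theorem isOpen_disc : IsOpen c.disc := Metric.isOpen_ball

theorem center_mem_disc : c.center ∈ c.disc := Metric.mem_ball_self c.radius_pos

end SurfaceChart

/-- The derivative at `u` is bounded below by `K⁻¹`, and strict differentiability keeps ψ within
`K⁻¹ / 2` of it on a small ball, so ψ is bi-Lipschitz there. -/
theorem IsRegularSurface.exists_chart {S : Set Space} (hS : IsRegularSurface S) (p : S) :
    ∃ c : SurfaceChart S, c.lift c.center = p := by
  obtain ⟨U, W, ψ, hU, hW, hpW, hψ, hinj, hemb, himg⟩ := hS p p.2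
  obtain ⟨u, huU, hup⟩ : (p : Space) ∈ ψ '' U := himg ▸ ⟨hpW, p.2⟩
  have hmem : ∀ v ∈ U, ψ v ∈ S := fun v hv => (himg ▸ mem_image_of_mem ψ hv : ψ v ∈ W ∩ S).2
  have hstr : HasStrictFDerivAt ψ (fderiv ℝ ψ u) u :=
    (hψ.contDiffAt (hU.mem_nhds huU)).hasStrictFDerivAt (by simp)
  obtain ⟨K, hK0, hK⟩ := (fderiv ℝ ψ u).toLinearMap.exists_antilipschitzWith
    (LinearMap.ker_eq_bot.2 (hinj u huU))
  obtain ⟨N, hN, hanti⟩ : ∃ N ∈ 𝓝 u, ApproximatesLinearOn ψ (fderiv ℝ ψ u) N (K⁻¹ / 2) :=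
    hstr.approximates_deriv_on_nhds (Or.inr (by positivity))
  obtain ⟨r, hr, hball⟩ := Metric.mem_nhds_iff.1 (inter_mem hN (hU.mem_nhds huU))
  have hlt : K⁻¹ / 2 < K⁻¹ := NNReal.half_lt_self (by positivity)
  have hBN := hanti.mono_set (hball.trans inter_subset_left)
  have hBU : Metric.ball u r ⊆ U := hball.trans inter_subset_right
  have hlip : ∀ a ∈ Metric.ball u r, ∀ b ∈ Metric.ball u r,
      edist a b ≤ ((K⁻¹ - K⁻¹ / 2)⁻¹ : NNReal) * edist (ψ a) (ψ b) := by
    have h : AntilipschitzWith (K⁻¹ - K⁻¹ / 2)⁻¹ ((Metric.ball u r).domRestrict ψ) := by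
      convert! (hK.domRestrict (Metric.ball u r)).add_lipschitzWith hBN.lipschitz_sub hlt
      simp [domRestrict]
    intro a ha b hb
    exact h ⟨a, ha⟩ ⟨b, hb⟩
  classical
  -- The value `p` outside `U` is arbitrary; only the disc matters.
  let g : Plane → S := fun v => if h : v ∈ U then ⟨ψ v, hmem v h⟩ else p
  have hg : ∀ v ∈ U, (g v : Space) = ψ v := fun v hv => by simp [g, hv]
  refine ⟨⟨u, r, hr, ψ, g, ‖fderiv ℝ ψ u‖₊ + K⁻¹ / 2, (K⁻¹ - K⁻¹ / 2)⁻¹, fun v hv => hg v (hBU hv),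
    hψ.mono hBU, fun v hv => hinj v (hBU hv), ?_, ?_, ?_⟩, Subtype.ext (by rw [hg u huU, hup])⟩
  · intro a ha b hb
    rw [Subtype.edist_eq, hg a (hBU ha), hg b (hBU hb)]
    exact hBN.lipschitz ⟨a, ha⟩ ⟨b, hb⟩
  · intro a ha b hb
    rw [Subtype.edist_eq, hg a (hBU ha), hg b (hBU hb)]
    exact hlip a ha b hb
  -- Relative openness of the image is where the embedding hypothesis enters: the ball is the
  -- preimage of an open `W'`.
  · obtain ⟨W', hW', hWB⟩ := hemb.isInducing.isOpen_iff.1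
      (Metric.isOpen_ball.preimage continuous_subtype_val :
        IsOpen (Subtype.val ⁻¹' (Metric.ball u r) : Set U))
    have : g '' Metric.ball u r = Subtype.val ⁻¹' (W' ∩ W) := by
      ext x
      constructor
      · rintro ⟨v, hv, rfl⟩
        have h1 : (⟨v, hBU hv⟩ : U) ∈ U.domRestrict ψ ⁻¹' W' := hWB ▸ hv
        have h2 : ψ v ∈ W ∩ S := himg ▸ mem_image_of_mem ψ (hBU hv)
        rw [mem_preimage, hg v (hBU hv)]
        exact ⟨h1, h2.1⟩
      · rintro ⟨h1, h2⟩
        obtain ⟨v, hv, hvx⟩ : (x : Space) ∈ ψ '' U := himg ▸ ⟨h2, x.2⟩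
        have : (⟨v, hv⟩ : U) ∈ U.domRestrict ψ ⁻¹' W' := by
          simpa [mem_preimage, domRestrict, hvx] using h1
        rw [hWB] at this
        exact ⟨v, this, Subtype.ext (by rw [hg v hv, hvx])⟩
    rw [this]
    exact (hW'.inter hW).preimage continuous_subtype_val

theorem ContinuousLinearMap.isUnit_adjoint_comp_self {E F : Type*} [NormedAddCommGroup E]
    [InnerProductSpace ℝ E] [FiniteDimensional ℝ E] [NormedAddCommGroup F] [InnerProductSpace ℝ F]
    [FiniteDimensional ℝ F] (A : E →L[ℝ] F) (hA : Function.Injective A) :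
    IsUnit (A.adjoint ∘L A) := by
  have hinj : Function.Injective (A.adjoint ∘L A) := by
    rw [injective_iff_map_eq_zero]
    intro x hx
    have h : inner ℝ (A x) (A x) = 0 := by
      rw [← ContinuousLinearMap.adjoint_inner_left]
      simp only [ContinuousLinearMap.comp_apply] at hx
      simp [hx]
    exact (injective_iff_map_eq_zero A).1 hA x (inner_self_eq_zero.1 h)
  rw [ContinuousLinearMap.isUnit_iff_bijective]
  exact ⟨hinj, LinearMap.injective_iff_surjective.1
      (show Function.Injective (A.adjoint ∘L A).toLinearMap from hinj)⟩

/-- The normal equations give the projection as A(A*A)⁻¹A*. In this form it visibly depends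
continuously on A, which yields the continuity of the tangential gradient. -/
theorem LinearMap.starProjection_range_eq {E F : Type*} [NormedAddCommGroup E]
    [InnerProductSpace ℝ E] [FiniteDimensional ℝ E] [NormedAddCommGroup F] [InnerProductSpace ℝ F]
    [FiniteDimensional ℝ F] (A : E →L[ℝ] F) (hA : Function.Injective A) (y : F) :
    (LinearMap.range A.toLinearMap).starProjection y
      = A (Ring.inverse (A.adjoint ∘L A) (A.adjoint y)) := by
  have hunit := A.isUnit_adjoint_comp_self hA
  refine Submodule.eq_starProjection_of_mem_of_inner_eq_zero ⟨_, rfl⟩ ?_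
  rintro _ ⟨x, rfl⟩
  have h : (A.adjoint ∘L A) (Ring.inverse (A.adjoint ∘L A) (A.adjoint y)) = A.adjoint y := by
    have := congr($(Ring.mul_inverse_cancel _ hunit) (A.adjoint y))
    simpa using this
  have h2 : A.adjoint (y - A (Ring.inverse (A.adjoint ∘L A) (A.adjoint y))) = 0 := by
    rw [map_sub, sub_eq_zero]
    exact h.symm
  change inner ℝ _ (A x) = 0
  rw [← ContinuousLinearMap.adjoint_inner_left, h2, inner_zero_left]

namespace SurfaceChart

variable {S : Set Space} (c : SurfaceChart S)

theorem continuousOn_lift : ContinuousOn c.lift c.disc := c.lipschitzOn.continuousOn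

theorem image_mem_nhds {v : Plane} (hv : v ∈ c.disc) : c.lift '' c.disc ∈ 𝓝 (c.lift v) :=
  c.isOpen_image.mem_nhds (mem_image_of_mem _ hv)

theorem map_nhds_eq {v : Plane} (hv : v ∈ c.disc) : map c.lift (𝓝 v) = 𝓝 (c.lift v) := by
  apply le_antisymm
  · exact c.continuousOn_lift.continuousAt (c.isOpen_disc.mem_nhds hv)
  · intro T hT
    obtain ⟨ε, hε, hεT⟩ := EMetric.mem_nhds_iff.1 (mem_map.1 hT)
    have h1 : Tendsto (fun x => (c.antilip : ENNReal) * edist x (c.lift v)) (𝓝 (c.lift v))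
        (𝓝 0) := by
      have : Tendsto (fun x => edist x (c.lift v)) (𝓝 (c.lift v)) (𝓝 0) := by
        simpa using (continuous_id.edist (continuous_const (y := c.lift v))).tendsto (c.lift v)
      simpa using ENNReal.Tendsto.const_mul this (Or.inr ENNReal.coe_ne_top)
    filter_upwards [h1.eventually_lt_const hε, c.image_mem_nhds hv]
    rintro _ hx ⟨w, hw, rfl⟩
    exact hεT (lt_of_le_of_lt (c.edist_le w hw v hv) hx)

theorem nhdsWithin_eq {v : Plane} (hv : v ∈ c.disc) : 𝓝[S] (c.param v) = map c.param (𝓝 v) := by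
  have h1 : (c.lift v : Space) = c.param v := c.coe_lift v hv
  have h2 : map c.param (𝓝 v) = map (Subtype.val ∘ c.lift) (𝓝 v) :=
    map_congr (by filter_upwards [c.isOpen_disc.mem_nhds hv] with w hw using (c.coe_lift w hw).symm)
  rw [h2, ← Filter.map_map, c.map_nhds_eq hv, map_nhds_subtype_val, h1]

theorem hasFDerivAt {v : Plane} (hv : v ∈ c.disc) :
    HasFDerivAt c.param (fderiv ℝ c.param v) v :=
  ((c.contDiffOn.contDiffAt (c.isOpen_disc.mem_nhds hv)).differentiableAt (by simp)).hasFDerivAt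

theorem param_mem {v : Plane} (hv : v ∈ c.disc) : c.param v ∈ S := c.coe_lift v hv ▸ (c.lift v).2

theorem fderiv_mem_surfaceTangent {v : Plane} (hv : v ∈ c.disc) (w : Plane) :
    fderiv ℝ c.param v w ∈ surfaceTangent S (c.param v) := by
  apply Submodule.subset_span
  have h := HasFDerivWithinAt.mapsTo_tangent_cone
    ((c.hasFDerivAt hv).hasFDerivWithinAt (s := c.disc))
  have h1 : tangentConeAt ℝ c.disc v = univ :=
    tangentConeAt_of_mem_nhds (c.isOpen_disc.mem_nhds hv)
  refine tangentConeAt_mono ?_ (h (h1 ▸ mem_univ w))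
  rintro _ ⟨w, hw, rfl⟩
  exact c.param_mem hw

/-- For the nontrivial inclusion, let `Q` be the projection off the range of the derivative. Along
`S` the map `Q` has derivative zero at the point, and derivatives within `S` are determined on the
tangent cone, so `Q` kills every tangent vector. -/
theorem surfaceTangent_eq {v : Plane} (hv : v ∈ c.disc) :
    surfaceTangent S (c.param v) = LinearMap.range (fderiv ℝ c.param v).toLinearMap := by
  apply le_antisymm
  · set R := LinearMap.range (fderiv ℝ c.param v).toLinearMap with hR
    refine Submodule.span_le.2 fun y hy => ?_
    set Q : Space →L[ℝ] Space := ContinuousLinearMap.id ℝ Space - R.starProjection with hQ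
    have hQR : ∀ z ∈ R, Q z = 0 := fun z hz => by
      simp [hQ, Submodule.starProjection_eq_self_iff.2 hz]
    have h0 : HasFDerivWithinAt Q (0 : Space →L[ℝ] Space) S (c.param v) := by
      rw [hasFDerivWithinAt_iff_isLittleO, c.nhdsWithin_eq hv, Asymptotics.isLittleO_map]
      have h1 : (fun w => Q (c.param w - c.param v - fderiv ℝ c.param v (w - v)))
          =o[𝓝 v] fun w => w - v :=
        (Q.isBigO_comp _ _).trans_isLittleO (hasFDerivAt_iff_isLittleO.1 (c.hasFDerivAt hv))
      -- The inverse Lipschitz bound turns an error o(|w - v|) in the parameter into an error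
      -- relative to distance on the surface.
      have h2 : (fun w => w - v) =O[𝓝 v] fun w => c.param w - c.param v := by
        refine Asymptotics.IsBigO.of_bound c.antilip ?_
        filter_upwards [c.isOpen_disc.mem_nhds hv] with w hw
        have := c.edist_le w hw v hv
        rw [Subtype.edist_eq, c.coe_lift w hw, c.coe_lift v hv, edist_nndist, edist_nndist] at this
        rw [← dist_eq_norm, ← dist_eq_norm]
        exact_mod_cast this
      refine (h1.trans_isBigO h2).congr_left fun w => ?_
      have h3 : Q (fderiv ℝ c.param v (w - v)) = 0 := hQR _ ⟨w - v, rfl⟩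
      rw [map_sub, map_sub, h3]
      simp
    have h1 : Q y = 0 := (Q.hasFDerivWithinAt (s := S) (x := c.param v)).unique_on h0 hy
    have h2 : y = R.starProjection y := sub_eq_zero.1 h1
    rw [h2]
    exact Submodule.starProjection_apply_mem _ _
  · rintro _ ⟨w, rfl⟩
    exact c.fderiv_mem_surfaceTangent hv w

theorem continuousAt_lift_iff {X : Type*} [TopologicalSpace X] {F : S → X} {v : Plane}
    (hv : v ∈ c.disc) : ContinuousAt F (c.lift v) ↔ ContinuousAt (F ∘ c.lift) v := by
  rw [ContinuousAt, ← c.map_nhds_eq hv, tendsto_map'_iff, ContinuousAt, Function.comp_apply]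

end SurfaceChart

theorem IsRegularSurface.continuous_surfaceGradient {S : Set Space} (hS : IsRegularSurface S)
    {φ : Space → ℝ} (hφ : ContDiff ℝ 1 φ) : Continuous fun x : S => surfaceGradient S φ x := by
  rw [continuous_iff_continuousAt]
  intro x
  obtain ⟨c, rfl⟩ := hS.exists_chart x
  rw [c.continuousAt_lift_iff c.center_mem_disc]
  have hnhds := c.isOpen_disc.mem_nhds c.center_mem_disc
  have hD : ContinuousAt (fderiv ℝ c.param) c.center :=
    (c.contDiffOn.continuousOn_fderiv_of_isOpen c.isOpen_disc (by simp)).continuousAt hnhds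
  have hcont : ContinuousAt (fun v => fderiv ℝ c.param v (Ring.inverse
      ((fderiv ℝ c.param v).adjoint ∘L (fderiv ℝ c.param v))
      ((fderiv ℝ c.param v).adjoint (gradient φ (c.param v))))) c.center := by
    have hA : ContinuousAt (fun v => (fderiv ℝ c.param v).adjoint) c.center :=
      (ContinuousLinearMap.adjoint (𝕜 := ℝ)).continuous.continuousAt.comp hD
    have hp : ContinuousAt c.param c.center := (c.hasFDerivAt c.center_mem_disc).continuousAt
    have hg : Continuous (gradient φ) :=
      (InnerProductSpace.toDual ℝ Space).symm.continuous.comp (hφ.continuous_fderiv (by simp))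
    have hinv : ContinuousAt (fun v => Ring.inverse
        ((fderiv ℝ c.param v).adjoint ∘L (fderiv ℝ c.param v))) c.center := by
      obtain ⟨a, ha⟩ := (fderiv ℝ c.param c.center).isUnit_adjoint_comp_self
        (c.injective_fderiv _ c.center_mem_disc)
      have h1 := NormedRing.inverse_continuousAt a
      rw [ha] at h1
      exact ContinuousAt.comp (f := fun v => (fderiv ℝ c.param v).adjoint ∘L (fderiv ℝ c.param v))
        h1 (hA.clm_comp hD)
    exact hD.clm_apply (hinv.clm_apply (hA.clm_apply (hg.continuousAt.comp hp)))
  refine hcont.congr ?_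
  filter_upwards [hnhds] with v hv
  rw [Function.comp_apply, c.coe_lift v hv, surfaceGradient,
    ← LinearMap.starProjection_range_eq _ (c.injective_fderiv v hv)]
  simp only [c.surfaceTangent_eq hv]

/-! ### Comparison of area with Lebesgue measure in a chart. -/

theorem LipschitzOnWith.euclideanHausdorffMeasure_image_le {X Y : Type*} [EMetricSpace X]
    [MeasurableSpace X] [BorelSpace X] [EMetricSpace Y] [MeasurableSpace Y] [BorelSpace Y]
    {K : NNReal} {f : X → Y} {s : Set X} (h : LipschitzOnWith K f s) (d : ℕ) :
    (Measure.euclideanHausdorffMeasure d : Measure Y) (f '' s)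
      ≤ (K : ENNReal) ^ d * (Measure.euclideanHausdorffMeasure d : Measure X) s := by
  have := h.hausdorffMeasure_image_le (d := d) (by positivity)
  rw [ENNReal.rpow_natCast] at this
  rw [Measure.euclideanHausdorffMeasure_def, Measure.euclideanHausdorffMeasure_def, Measure.smul_apply,
    Measure.smul_apply,
    ENNReal.smul_def, ENNReal.smul_def, smul_eq_mul, smul_eq_mul, mul_left_comm]
  gcongr

namespace SurfaceChart

variable {S : Set Space} (c : SurfaceChart S)

theorem surfaceArea_image_le {A : Set Plane} (hA : A ⊆ c.disc) :
    surfaceArea S (c.lift '' A) ≤ (c.lip : ENNReal) ^ 2 * volume A := by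
  rw [surfaceArea, ← EuclideanSpace.euclideanHausdorffMeasure_eq_volume]
  exact (c.lipschitzOn.mono hA).euclideanHausdorffMeasure_image_le 2

theorem injOn_lift : InjOn c.lift c.disc := by
  intro a ha b hb h
  simpa [h] using c.edist_le a ha b hb

theorem volume_le {A : Set Plane} (hA : A ⊆ c.disc) :
    volume A ≤ (c.antilip : ENNReal) ^ 2 * surfaceArea S (c.lift '' A) := by
  rw [surfaceArea, ← EuclideanSpace.euclideanHausdorffMeasure_eq_volume]
  have h : LipschitzOnWith c.antilip (Function.invFunOn c.lift c.disc) (c.lift '' A) := by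
    rintro _ ⟨a, ha, rfl⟩ _ ⟨b, hb, rfl⟩
    rw [c.injOn_lift.leftInvOn_invFunOn (hA ha), c.injOn_lift.leftInvOn_invFunOn (hA hb)]
    exact c.edist_le a (hA ha) b (hA hb)
  have h2 := h.euclideanHausdorffMeasure_image_le 2
  rwa [image_image, image_congr (fun a ha => c.injOn_lift.leftInvOn_invFunOn (hA ha)),
    image_id'] at h2

theorem aemeasurable_lift : AEMeasurable c.lift (volume.restrict c.disc) :=
  c.continuousOn_lift.aemeasurable c.isOpen_disc.measurableSet

theorem map_volume_le :
    (volume.restrict c.disc).map c.lift ≤ (c.antilip : ENNReal) ^ 2 • surfaceArea S := by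
  refine Measure.le_iff.2 fun T hT => ?_
  -- Outside the disc `lift` is arbitrary, so measurability is argued relative to the disc.
  have hm : MeasurableSet (c.disc ∩ c.lift ⁻¹' T) := by
    obtain ⟨u, hu, hu'⟩ :=
      (continuousOn_iff_continuous_domRestrict.1 c.continuousOn_lift).measurable hT
    have : c.disc ∩ c.lift ⁻¹' T = c.disc ∩ u := by
      ext x
      constructor
      · rintro ⟨hx, hxT⟩
        exact ⟨hx, (Set.ext_iff.1 hu' ⟨x, hx⟩).2 hxT⟩
      · rintro ⟨hx, hxT⟩
        exact ⟨hx, (Set.ext_iff.1 hu' ⟨x, hx⟩).1 hxT⟩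
    rw [this]
    exact c.isOpen_disc.measurableSet.inter hu
  rw [Measure.map_apply_of_aemeasurable c.aemeasurable_lift hT,
    Measure.restrict_apply' c.isOpen_disc.measurableSet, inter_comm, Measure.smul_apply,
    smul_eq_mul]
  refine (c.volume_le inter_subset_left).trans ?_
  gcongr
  rintro _ ⟨a, ha, rfl⟩
  exact ha.2

theorem lintegral_comp_le {F : S → ENNReal} (hF : AEMeasurable F (surfaceArea S)) :
    ∫⁻ v in c.disc, F (c.lift v) ≤ (c.antilip : ENNReal) ^ 2 * ∫⁻ x, F x ∂surfaceArea S := by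
  have hF' : AEMeasurable F ((volume.restrict c.disc).map c.lift) :=
    (hF.smul_measure _).mono_measure c.map_volume_le
  rw [← lintegral_map' hF' c.aemeasurable_lift]
  refine (lintegral_mono' c.map_volume_le le_rfl).trans ?_
  rw [lintegral_smul_measure, smul_eq_mul]

theorem ae_image_of_ae {P : S → Prop} (h : ∀ᵐ v ∂volume.restrict c.disc, P (c.lift v)) :
    ∀ᵐ x ∂surfaceArea S, x ∈ c.lift '' c.disc → P x := by
  rw [ae_restrict_iff' c.isOpen_disc.measurableSet, ae_iff] at h
  have h2 := c.surfaceArea_image_le (A := {v | ¬ (v ∈ c.disc → P (c.lift v))})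
    fun v hv => (Classical.not_imp.1 hv).1
  rw [h, mul_zero, nonpos_iff_eq_zero] at h2
  rw [ae_iff]
  refine measure_mono_null ?_ h2
  intro x hx
  obtain ⟨⟨v, hv, rfl⟩, h3⟩ := Classical.not_imp.1 hx
  exact ⟨v, Classical.not_imp.2 ⟨hv, h3⟩, rfl⟩

end SurfaceChart

theorem IsRegularSurface.isFiniteMeasure_surfaceArea {S : Set Space} (hS : IsRegularSurface S)
    [CompactSpace S] : IsFiniteMeasure (surfaceArea S) := by
  have : IsLocallyFiniteMeasure (surfaceArea S) := ⟨fun x => by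
    obtain ⟨c, rfl⟩ := hS.exists_chart x
    refine ⟨c.lift '' c.disc, c.image_mem_nhds c.center_mem_disc,
      (c.surfaceArea_image_le subset_rfl).trans_lt ?_⟩
    exact ENNReal.mul_lt_top (by simp) Metric.isBounded_ball.measure_lt_top⟩
  exact CompactSpace.isFiniteMeasure

/-! ### Convergence in L². -/

theorem MeasureTheory.tendsto_eLpNorm_two_of_dominated {α E : Type*} [MeasurableSpace α]
    {μ : Measure α} [NormedAddCommGroup E] {F : ℕ → α → E} {g : α → ℝ}
    (hF : ∀ n, AEStronglyMeasurable (F n) μ) (hg : MemLp g 2 μ)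
    (hle : ∀ n, ∀ᵐ x ∂μ, ‖F n x‖ ≤ ‖g x‖)
    (hlim : ∀ᵐ x ∂μ, Tendsto (fun n => F n x) atTop (𝓝 0)) :
    Tendsto (fun n => eLpNorm (F n) 2 μ) atTop (𝓝 0) := by
  have hfin : ∫⁻ x, ‖g x‖ₑ ^ (2 : ℝ) ∂μ ≠ ⊤ := by
    have := lintegral_rpow_enorm_lt_top_of_eLpNorm_lt_top (by norm_num) (by norm_num) hg.2
    simpa using this.ne
  have h : Tendsto (fun n => ∫⁻ x, ‖F n x‖ₑ ^ (2 : ℝ) ∂μ) atTop (𝓝 (∫⁻ _, 0 ∂μ)) := by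
    refine tendsto_lintegral_of_dominated_convergence' (fun x => ‖g x‖ₑ ^ (2 : ℝ))
      (fun n => (hF n).enorm.pow_const _) (fun n => ?_) hfin ?_
    · filter_upwards [hle n] with x hx
      gcongr
      exact enorm_le_iff_norm_le.2 hx
    · filter_upwards [hlim] with x hx
      have := (ENNReal.continuous_rpow_const (y := 2)).tendsto _ |>.comp (hx.enorm)
      simpa [Function.comp_def] using this
  rw [lintegral_zero] at h
  have h2 := ((ENNReal.continuous_rpow_const (y := 1 / 2)).tendsto _).comp h
  simp only [eLpNorm_eq_lintegral_rpow_enorm_toReal (p := 2) (by norm_num) (by norm_num)]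
  simpa [Function.comp_def] using h2

theorem MeasureTheory.eLpNorm_le_coe_mul {α E F : Type*} [MeasurableSpace α] {μ : Measure α}
    [NormedAddCommGroup E] [NormedAddCommGroup F] {u : α → E} {w : α → F} {C : NNReal}
    (h : ∀ x, ‖u x‖ ≤ C * ‖w x‖) (p : ENNReal) :
    eLpNorm u p μ ≤ (C : ENNReal) * eLpNorm w p μ := by
  have h1 : ∀ᵐ x ∂μ, ‖u x‖₊ ≤ C * ‖w x‖₊ := Eventually.of_forall fun x => h x
  have h2 := eLpNorm_le_nnreal_smul_eLpNorm_of_ae_le_mul h1 p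
  rwa [ENNReal.smul_def, smul_eq_mul] at h2

theorem MeasureTheory.tendsto_coe_mul_eLpNorm {α E : Type*} [MeasurableSpace α] {μ : Measure α}
    [NormedAddCommGroup E] {u : ℕ → α → E} {p : ENNReal} (C : NNReal)
    (h : Tendsto (fun n => eLpNorm (u n) p μ) atTop (𝓝 0)) :
    Tendsto (fun n => (C : ENNReal) * eLpNorm (u n) p μ) atTop (𝓝 0) := by
  simpa using ENNReal.Tendsto.const_mul (a := (C : ENNReal)) h (Or.inr ENNReal.coe_ne_top)

/-- Split aₙFₙ - bG = aₙ(Fₙ - G) + (aₙ - b)G. The first term is controlled by the uniform bound on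
aₙ, the second by dominated convergence with majorant 2C|G|. -/
theorem MeasureTheory.tendsto_eLpNorm_two_smul_sub {α E : Type*} [MeasurableSpace α]
    {μ : Measure α} [NormedAddCommGroup E] [NormedSpace ℝ E] {a : ℕ → α → ℝ} {b : α → ℝ}
    {F : ℕ → α → E} {G : α → E} {C : NNReal}
    (ha : ∀ n, AEStronglyMeasurable (a n) μ) (hb : AEStronglyMeasurable b μ)
    (hF : ∀ n, AEStronglyMeasurable (F n) μ) (hG : MemLp G 2 μ)
    (haC : ∀ n x, ‖a n x‖ ≤ C) (hbC : ∀ x, ‖b x‖ ≤ C)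
    (hlim : ∀ᵐ x ∂μ, Tendsto (fun n => a n x) atTop (𝓝 (b x)))
    (hFG : Tendsto (fun n => eLpNorm (fun x => F n x - G x) 2 μ) atTop (𝓝 0)) :
    Tendsto (fun n => eLpNorm (fun x => a n x • F n x - b x • G x) 2 μ) atTop (𝓝 0) := by
  have h1 := tendsto_coe_mul_eLpNorm C hFG
  have h2 : Tendsto (fun n => eLpNorm (fun x => (a n x - b x) • G x) 2 μ) atTop (𝓝 0) := by
    have hg : MemLp (fun x => (2 * (C : ℝ)) * ‖G x‖) 2 μ := hG.norm.const_mul _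
    refine tendsto_eLpNorm_two_of_dominated (fun n => ((ha n).sub hb).smul hG.1) hg
      (fun n => Eventually.of_forall fun x => ?_) ?_
    · rw [norm_smul, norm_mul, norm_norm]
      refine mul_le_mul_of_nonneg_right ?_ (norm_nonneg _)
      rw [Real.norm_of_nonneg (by positivity : (0 : ℝ) ≤ 2 * C)]
      linarith [norm_sub_le (a n x) (b x), haC n x, hbC x]
    · filter_upwards [hlim] with x hx
      have h := (hx.sub_const (b x)).smul_const (G x)
      simpa using h
  have h3 := h1.add h2
  rw [add_zero] at h3
  have key : ∀ n, eLpNorm (fun x => a n x • F n x - b x • G x) 2 μ ≤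
      C * eLpNorm (fun x => F n x - G x) 2 μ + eLpNorm (fun x => (a n x - b x) • G x) 2 μ := by
    intro n
    have h4 := eLpNorm_add_le (p := 2) (f := fun x => a n x • (F n x - G x))
      (g := fun x => (a n x - b x) • G x) ((ha n).smul ((hF n).sub hG.1))
      (((ha n).sub hb).smul hG.1) (by norm_num)
    have h5 : eLpNorm (fun x => a n x • (F n x - G x)) 2 μ
        ≤ C * eLpNorm (fun x => F n x - G x) 2 μ := by
      refine eLpNorm_le_coe_mul (fun x => ?_) 2
      rw [norm_smul]
      exact mul_le_mul_of_nonneg_right (haC n x) (norm_nonneg _)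
    refine le_trans (le_of_eq ?_) (h4.trans (add_le_add_left h5 _))
    congr 1
    ext1 x
    simp only [Pi.add_apply]
    module
  exact tendsto_of_tendsto_of_tendsto_of_le_of_le tendsto_const_nhds h3 (fun _ => zero_le) key

/-! ### Calculus of Sobolev functions on the surface. -/

section Gradient

variable {S : Set Space} {φ ψ : Space → ℝ}

theorem surfaceGradient_add (hφ : ContDiff ℝ ∞ φ) (hψ : ContDiff ℝ ∞ ψ) (p : Space) :
    surfaceGradient S (fun x => φ x + ψ x) p = surfaceGradient S φ p + surfaceGradient S ψ p := by
  have h : gradient (fun x => φ x + ψ x) p = gradient φ p + gradient ψ p := by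
    rw [gradient, gradient, gradient, ← map_add]
    congr 1
    exact fderiv_add ((hφ.differentiable (by simp)) p) ((hψ.differentiable (by simp)) p)
  rw [surfaceGradient, h, map_add]
  rfl

theorem surfaceGradient_comp {ρ : ℝ → ℝ} (hρ : ContDiff ℝ ∞ ρ) (hφ : ContDiff ℝ ∞ φ) (p : Space) :
    surfaceGradient S (fun x => ρ (φ x)) p = deriv ρ (φ p) • surfaceGradient S φ p := by
  have h : gradient (fun x => ρ (φ x)) p = deriv ρ (φ p) • gradient φ p := by
    have h1 : fderiv ℝ (fun x => ρ (φ x)) p = deriv ρ (φ p) • fderiv ℝ φ p :=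
      ((hρ.differentiable (by simp) (φ p)).hasDerivAt.comp_hasFDerivAt p
        (hφ.differentiable (by simp) p).hasFDerivAt).fderiv
    rw [gradient, h1, gradient, map_smulₛₗ]
    rfl
  rw [surfaceGradient, h, map_smul]
  rfl

theorem surfaceGradient_const_mul (hφ : ContDiff ℝ ∞ φ) (a : ℝ) (p : Space) :
    surfaceGradient S (fun x => a * φ x) p = a • surfaceGradient S φ p := by
  have h := surfaceGradient_comp (S := S) (ρ := fun t => a * t) (by fun_prop) hφ p
  rw [h]
  congr 1
  simp

theorem surfaceGradient_const (a : ℝ) (p : Space) :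
    surfaceGradient S (fun _ => a) p = 0 := by
  simp [surfaceGradient]

end Gradient

theorem HasSobolevGradient.exists_smooth {S : Set Space} {V : S → ℝ} {G : S → Space}
    (h : HasSobolevGradient S V G) {ε : ENNReal} (hε : 0 < ε) :
    ∃ φ : Space → ℝ, ContDiff ℝ ∞ φ ∧ eLpNorm (fun x : S => φ x - V x) 2 (surfaceArea S) ≤ ε ∧
      eLpNorm (fun x : S => surfaceGradient S φ x - G x) 2 (surfaceArea S) ≤ ε := by
  obtain ⟨-, -, φ, hφ, h1, h2⟩ := h
  obtain ⟨n, hn1, hn2⟩ := ((h1.eventually_le_const hε).and (h2.eventually_le_const hε)).exists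
  exact ⟨φ n, hφ n, hn1, hn2⟩

/-- One approximant for each ε suffices, which replaces diagonal sequences by ε/2 arguments. -/
theorem HasSobolevGradient.of_exists_smooth {S : Set Space} {V : S → ℝ} {G : S → Space}
    (hV : MemLp V 2 (surfaceArea S)) (hG : MemLp G 2 (surfaceArea S))
    (h : ∀ ε : ENNReal, 0 < ε → ∃ φ : Space → ℝ, ContDiff ℝ ∞ φ ∧
      eLpNorm (fun x : S => φ x - V x) 2 (surfaceArea S) ≤ ε ∧
      eLpNorm (fun x : S => surfaceGradient S φ x - G x) 2 (surfaceArea S) ≤ ε) :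
    HasSobolevGradient S V G := by
  choose φ hφ h1 h2 using fun n : ℕ => h ((n : ENNReal) + 1)⁻¹ (by simp [ENNReal.add_eq_top])
  have hlim : Tendsto (fun n : ℕ => ((n : ENNReal) + 1)⁻¹) atTop (𝓝 0) := by
    have := (tendsto_add_atTop_iff_nat 1).2 ENNReal.tendsto_inv_nat_nhds_zero
    simpa using this
  exact ⟨hV, hG, φ, hφ, tendsto_of_tendsto_of_tendsto_of_le_of_le tendsto_const_nhds hlim
    (fun _ => zero_le) h1, tendsto_of_tendsto_of_tendsto_of_le_of_le tendsto_const_nhds hlim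
    (fun _ => zero_le) h2⟩

theorem HasSobolevGradient.congr {S : Set Space} {V W : S → ℝ} {G K : S → Space}
    (h : HasSobolevGradient S V G) (hVW : V =ᵐ[surfaceArea S] W) (hGK : G =ᵐ[surfaceArea S] K) :
    HasSobolevGradient S W K := by
  obtain ⟨hV, hG, φ, hφ, h1, h2⟩ := h
  refine ⟨hV.ae_eq hVW, hG.ae_eq hGK, φ, hφ, h1.congr fun n => eLpNorm_congr_ae ?_,
    h2.congr fun n => eLpNorm_congr_ae ?_⟩
  · filter_upwards [hVW] with x hx
    rw [hx]
  · filter_upwards [hGK] with x hx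
    rw [hx]

theorem HasSobolevGradient.const_mul {S : Set Space} {V : S → ℝ} {G : S → Space}
    (hV : HasSobolevGradient S V G) (a : ℝ) :
    HasSobolevGradient S (fun x => a * V x) (fun x => a • G x) := by
  obtain ⟨hV1, hG, φ, hφ, h1, h2⟩ := hV
  refine ⟨hV1.const_mul a, hG.const_smul a, fun n x => a * φ n x,
    fun n => contDiff_const.mul (hφ n), ?_, ?_⟩
  · have := ENNReal.Tendsto.const_mul (a := ‖a‖ₑ) h1 (Or.inr enorm_ne_top)
    rw [mul_zero] at this
    refine this.congr fun n => ?_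
    rw [← eLpNorm_const_smul]
    simp [Pi.smul_def, mul_sub]
  · have := ENNReal.Tendsto.const_mul (a := ‖a‖ₑ) h2 (Or.inr enorm_ne_top)
    rw [mul_zero] at this
    refine this.congr fun n => ?_
    rw [← eLpNorm_const_smul]
    simp [Pi.smul_def, surfaceGradient_const_mul (hφ n), smul_sub]

namespace IsRegularSurface

variable {S : Set Space} (hS : IsRegularSurface S) [CompactSpace S]
include hS

theorem memLp_of_continuous {E : Type*} [NormedAddCommGroup E]
    [SecondCountableTopologyEither S E] {F : S → E} (hF : Continuous F) (p : ENNReal) :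
    MemLp F p (surfaceArea S) := by
  have := hS.isFiniteMeasure_surfaceArea
  exact hF.memLp_of_hasCompactSupport (HasCompactSupport.of_compactSpace F)

theorem memLp_smooth {φ : Space → ℝ} (hφ : ContDiff ℝ ∞ φ) :
    MemLp (fun x : S => φ x) 2 (surfaceArea S) :=
  hS.memLp_of_continuous (hφ.continuous.comp continuous_subtype_val) 2

theorem memLp_surfaceGradient {φ : Space → ℝ} (hφ : ContDiff ℝ ∞ φ) :
    MemLp (fun x : S => surfaceGradient S φ x) 2 (surfaceArea S) :=
  hS.memLp_of_continuous (hS.continuous_surfaceGradient (hφ.of_le (by simp))) 2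

theorem hasSobolevGradient_smooth {φ : Space → ℝ} (hφ : ContDiff ℝ ∞ φ) :
    HasSobolevGradient S (fun x => φ x) (fun x => surfaceGradient S φ x) :=
  ⟨hS.memLp_smooth hφ, hS.memLp_surfaceGradient hφ, fun _ => φ, fun _ => hφ, by simp, by simp⟩

theorem hasSobolevGradient_const (a : ℝ) : HasSobolevGradient S (fun _ => a) (fun _ => 0) := by
  simpa [surfaceGradient_const] using hS.hasSobolevGradient_smooth (φ := fun _ => a) contDiff_const

theorem hasSobolevGradient_of_tendsto {V : ℕ → S → ℝ} {G : ℕ → S → Space} {W : S → ℝ}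
    {K : S → Space} (h : ∀ n, HasSobolevGradient S (V n) (G n))
    (hW : MemLp W 2 (surfaceArea S)) (hK : MemLp K 2 (surfaceArea S))
    (h1 : Tendsto (fun n => eLpNorm (fun x => V n x - W x) 2 (surfaceArea S)) atTop (𝓝 0))
    (h2 : Tendsto (fun n => eLpNorm (fun x => G n x - K x) 2 (surfaceArea S)) atTop (𝓝 0)) :
    HasSobolevGradient S W K := by
  refine HasSobolevGradient.of_exists_smooth hW hK fun ε hε => ?_
  have hε2 : 0 < ε / 2 := ENNReal.half_pos hε.ne'
  obtain ⟨n, hn1, hn2⟩ := ((h1.eventually_le_const hε2).and (h2.eventually_le_const hε2)).exists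
  obtain ⟨φ, hφ, hφ1, hφ2⟩ := (h n).exists_smooth hε2
  refine ⟨φ, hφ, ?_, ?_⟩
  · have := eLpNorm_add_le (f := fun x : S => φ x - V n x) (g := fun x => V n x - W x)
      ((hS.memLp_smooth hφ).1.sub (h n).1.1) ((h n).1.1.sub hW.1) (p := 2) (by norm_num)
    simp only [Pi.add_def, sub_add_sub_cancel] at this
    exact this.trans ((add_le_add hφ1 hn1).trans (ENNReal.add_halves ε).le)
  · have := eLpNorm_add_le (f := fun x : S => surfaceGradient S φ x - G n x)
      (g := fun x => G n x - K x)
      ((hS.memLp_surfaceGradient hφ).1.sub (h n).2.1.1) ((h n).2.1.1.sub hK.1) (p := 2)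
      (by norm_num)
    simp only [Pi.add_def, sub_add_sub_cancel] at this
    exact this.trans ((add_le_add hφ2 hn2).trans (ENNReal.add_halves ε).le)

theorem hasSobolevGradient_add {V W : S → ℝ} {G K : S → Space} (hV : HasSobolevGradient S V G)
    (hW : HasSobolevGradient S W K) :
    HasSobolevGradient S (fun x => V x + W x) (fun x => G x + K x) := by
  refine HasSobolevGradient.of_exists_smooth (hV.1.add hW.1) (hV.2.1.add hW.2.1) fun ε hε => ?_
  have hε2 : 0 < ε / 2 := ENNReal.half_pos hε.ne'
  obtain ⟨φ, hφ, hφ1, hφ2⟩ := hV.exists_smooth hε2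
  obtain ⟨ψ, hψ, hψ1, hψ2⟩ := hW.exists_smooth hε2
  refine ⟨fun x => φ x + ψ x, hφ.add hψ, ?_, ?_⟩
  · have := eLpNorm_add_le ((hS.memLp_smooth hφ).1.sub hV.1.1) ((hS.memLp_smooth hψ).1.sub hW.1.1)
      (p := 2) (by norm_num)
    simp only [Pi.add_def, Pi.sub_def, sub_add_sub_comm] at this
    exact this.trans ((add_le_add hφ1 hψ1).trans (ENNReal.add_halves ε).le)
  · have := eLpNorm_add_le ((hS.memLp_surfaceGradient hφ).1.sub hV.2.1.1)
      ((hS.memLp_surfaceGradient hψ).1.sub hW.2.1.1) (p := 2) (by norm_num)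
    simp only [Pi.add_def, Pi.sub_def, sub_add_sub_comm] at this
    simp only [surfaceGradient_add hφ hψ]
    exact this.trans ((add_le_add hφ2 hψ2).trans (ENNReal.add_halves ε).le)

theorem hasSobolevGradient_sub {V W : S → ℝ} {G K : S → Space} (hV : HasSobolevGradient S V G)
    (hW : HasSobolevGradient S W K) :
    HasSobolevGradient S (fun x => V x - W x) (fun x => G x - K x) := by
  simpa [sub_eq_add_neg] using hS.hasSobolevGradient_add hV (hW.const_mul (-1))

theorem hasSobolevGradient_comp {V : S → ℝ} {G : S → Space} (hV : HasSobolevGradient S V G)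
    {ρ : ℝ → ℝ} (hρ : ContDiff ℝ ∞ ρ) {C : NNReal} (hC : ∀ t, ‖deriv ρ t‖₊ ≤ C) :
    HasSobolevGradient S (fun x => ρ (V x)) (fun x => deriv ρ (V x) • G x) := by
  have := hS.isFiniteMeasure_surfaceArea
  obtain ⟨hV1, hG, φ, hφ, h1, h2⟩ := hV
  have hlip : LipschitzWith C ρ := lipschitzWith_of_nnnorm_deriv_le (hρ.differentiable (by simp)) hC
  have hdc : Continuous (deriv ρ) := hρ.continuous_deriv (by simp)
  -- The derivatives ρ'(φₙ) need pointwise convergence, and L² convergence supplies it only along a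
  -- subsequence.
  obtain ⟨ns, hns, hae⟩ := (tendstoInMeasure_of_tendsto_eLpNorm (by norm_num : (2 : ENNReal) ≠ 0)
    (fun n => (hS.memLp_smooth (hφ n)).1) hV1.1 h1).exists_seq_tendsto_ae
  have h1' : Tendsto (fun n => eLpNorm (fun x : S => φ (ns n) x - V x) 2 (surfaceArea S))
      atTop (𝓝 0) := h1.comp hns.tendsto_atTop
  have h2' : Tendsto (fun n => eLpNorm (fun x : S => surfaceGradient S (φ (ns n)) x - G x) 2
      (surfaceArea S)) atTop (𝓝 0) := h2.comp hns.tendsto_atTop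
  have hdm : AEStronglyMeasurable (fun x => deriv ρ (V x)) (surfaceArea S) :=
    hdc.comp_aestronglyMeasurable hV1.1
  have hdG : MemLp (fun x => deriv ρ (V x) • G x) 2 (surfaceArea S) := by
    have hm : AEStronglyMeasurable (fun x => deriv ρ (V x) • G x) (surfaceArea S) := hdm.smul hG.1
    refine MemLp.of_le_mul hG hm (c := C) (Eventually.of_forall fun x => ?_)
    rw [norm_smul]
    exact mul_le_mul_of_nonneg_right (hC _) (norm_nonneg _)
  have hρV : MemLp (fun x => ρ (V x)) 2 (surfaceArea S) := by
    have h0 : MemLp (fun _ : S => ‖ρ 0‖) 2 (surfaceArea S) := memLp_const _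
    have h1 : MemLp (fun x => (C : ℝ) * ‖V x‖) 2 (surfaceArea S) := hV1.norm.const_mul _
    have h2 : MemLp (fun x => ‖ρ 0‖ + C * ‖V x‖) 2 (surfaceArea S) := h0.add h1
    have hm : AEStronglyMeasurable (fun x => ρ (V x)) (surfaceArea S) :=
      hρ.continuous.comp_aestronglyMeasurable hV1.1
    refine h2.of_le hm (Eventually.of_forall fun x => ?_)
    have h3 : ‖ρ (V x) - ρ 0‖ ≤ C * ‖V x‖ := by
      simpa [dist_eq_norm] using hlip.dist_le_mul (V x) 0
    refine le_trans ?_ (le_abs_self _)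
    exact (norm_le_norm_add_norm_sub' _ (ρ 0)).trans (add_le_add_right h3 _)
  have hsm : ∀ n, HasSobolevGradient S (fun x => ρ (φ (ns n) x))
      (fun x => surfaceGradient S (fun y => ρ (φ (ns n) y)) x) := fun n =>
    hS.hasSobolevGradient_smooth (φ := fun y => ρ (φ (ns n) y)) (hρ.comp (hφ _))
  refine hS.hasSobolevGradient_of_tendsto hsm hρV hdG ?_ ?_
  · have h3 := tendsto_coe_mul_eLpNorm C h1'
    have key : ∀ n, eLpNorm (fun x : S => ρ (φ (ns n) x) - ρ (V x)) 2 (surfaceArea S) ≤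
        C * eLpNorm (fun x : S => φ (ns n) x - V x) 2 (surfaceArea S) := by
      intro n
      refine eLpNorm_le_coe_mul (fun x => ?_) 2
      rw [← dist_eq_norm, ← dist_eq_norm]
      exact hlip.dist_le_mul _ _
    exact tendsto_of_tendsto_of_tendsto_of_le_of_le tendsto_const_nhds h3 (fun _ => zero_le) key
  · simp only [surfaceGradient_comp hρ (hφ _)]
    exact tendsto_eLpNorm_two_smul_sub
      (fun n => hdc.comp_aestronglyMeasurable (hS.memLp_smooth (hφ _)).1) hdm
      (fun n => (hS.memLp_surfaceGradient (hφ _)).1) hG (fun n x => hC _) (fun x => hC _)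
      (by filter_upwards [hae] with x hx using (hdc.tendsto (V x)).comp hx)
      h2'

end IsRegularSurface

/-! ### Positive parts. -/

/-- The derivative of `t ↦ t * Real.smoothTransition t`. -/
noncomputable def smoothPosPartDeriv (t : ℝ) : ℝ :=
  Real.smoothTransition t + t * deriv Real.smoothTransition t

theorem smoothPosPartDeriv_of_nonpos {t : ℝ} (ht : t ≤ 0) : smoothPosPartDeriv t = 0 := by
  rw [smoothPosPartDeriv, Real.smoothTransition.zero_of_nonpos ht, zero_add]
  rcases ht.eq_or_lt with rfl | h
  · simp
  · have : Real.smoothTransition =ᶠ[𝓝 t] fun _ => 0 := by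
      filter_upwards [Iio_mem_nhds h] with s hs
      using Real.smoothTransition.zero_of_nonpos (le_of_lt hs)
    simp [this.deriv_eq]

theorem smoothPosPartDeriv_of_one_lt {t : ℝ} (ht : 1 < t) : smoothPosPartDeriv t = 1 := by
  have : Real.smoothTransition =ᶠ[𝓝 t] fun _ => 1 := by
    filter_upwards [Ioi_mem_nhds ht] with s hs
      using Real.smoothTransition.one_of_one_le (le_of_lt hs)
  simp [smoothPosPartDeriv, Real.smoothTransition.one_of_one_le ht.le, this.deriv_eq]

theorem continuous_smoothPosPartDeriv : Continuous smoothPosPartDeriv :=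
  Real.smoothTransition.continuous.add (continuous_id.mul
    ((Real.smoothTransition.contDiff (n := 1)).continuous_deriv (by simp)))

theorem exists_nnnorm_smoothPosPartDeriv_le : ∃ C : NNReal, ∀ t, ‖smoothPosPartDeriv t‖₊ ≤ C := by
  obtain ⟨C, hC⟩ := isCompact_Icc.exists_bound_of_continuousOn
    (s := Icc (0 : ℝ) 1) continuous_smoothPosPartDeriv.continuousOn
  refine ⟨max C.toNNReal 1, fun t => ?_⟩
  rcases le_or_gt t 0 with h0 | h0
  · simp [smoothPosPartDeriv_of_nonpos h0]
  rcases lt_or_ge 1 t with h1 | h1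
  · simp [smoothPosPartDeriv_of_one_lt h1]
  · exact le_max_of_le_left (NNReal.le_toNNReal_of_coe_le (hC t ⟨h0.le, h1⟩))

/-- The functions t·σ(kt) are smooth approximations of max(t, 0) as k → ∞. Their derivatives depend
on kt alone, so one bound serves for all k. -/
theorem hasDerivAt_mul_smoothTransition (k t : ℝ) :
    HasDerivAt (fun t => t * Real.smoothTransition (k * t)) (smoothPosPartDeriv (k * t)) t := by
  have h1 : HasDerivAt Real.smoothTransition (deriv Real.smoothTransition (k * t)) (k * t) :=
    ((Real.smoothTransition.contDiff (n := 1)).differentiable (by simp) _).hasDerivAt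
  have h2 : HasDerivAt (fun t => k * t) k t := by simpa using (hasDerivAt_id t).const_mul k
  refine ((hasDerivAt_id t).mul (h1.comp t h2)).congr_deriv ?_
  simp only [smoothPosPartDeriv, Function.comp, id]
  ring

theorem IsRegularSurface.hasSobolevGradient_posPart {S : Set Space} (hS : IsRegularSurface S)
    [CompactSpace S] {V : S → ℝ} {G : S → Space} (hV : HasSobolevGradient S V G) :
    HasSobolevGradient S (fun x => max (V x) 0) ({x | 0 < V x}.indicator G) := by
  obtain ⟨C, hC⟩ := exists_nnnorm_smoothPosPartDeriv_le
  have hd : ∀ k, deriv (fun t => t * Real.smoothTransition (k * t))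
      = fun t => smoothPosPartDeriv (k * t) := fun k =>
    funext fun t => (hasDerivAt_mul_smoothTransition k t).deriv
  have hsm : ∀ n : ℕ, HasSobolevGradient S (fun x => V x * Real.smoothTransition (n * V x))
      (fun x => smoothPosPartDeriv (n * V x) • G x) := by
    intro n
    have h := hS.hasSobolevGradient_comp hV (ρ := fun t => t * Real.smoothTransition (n * t))
      (contDiff_id.mul (Real.smoothTransition.contDiff.comp (contDiff_const.mul contDiff_id)))
      (C := C) (fun t => by rw [hd]; exact hC _)
    simpa only [hd] using h
  obtain ⟨hV1, hG, -⟩ := id hV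
  have hev : ∀ t : ℝ, 0 < t → ∀ᶠ n : ℕ in atTop, 1 < n * t := fun t ht =>
    (tendsto_natCast_atTop_atTop.atTop_mul_const ht).eventually_gt_atTop 1
  have hlim1 : ∀ t : ℝ, Tendsto (fun n : ℕ => t * Real.smoothTransition (n * t) - max t 0) atTop
      (𝓝 0) := by
    intro t
    rcases le_or_gt t 0 with h | h
    · refine tendsto_const_nhds.congr fun n => ?_
      rw [Real.smoothTransition.zero_of_nonpos (mul_nonpos_of_nonneg_of_nonpos n.cast_nonneg h),
        max_eq_right h]
      simp
    · refine tendsto_const_nhds.congr' ?_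
      filter_upwards [hev t h] with n hn
      rw [Real.smoothTransition.one_of_one_le hn.le, max_eq_left h.le]
      simp
  -- The approximating derivatives vanish at 0, so the limit is exactly the indicator of (0, ∞). The
  -- set {V = 0} thus needs no separate argument that the gradient vanishes there.
  have hlim2 : ∀ t : ℝ, Tendsto (fun n : ℕ => smoothPosPartDeriv (n * t)) atTop
      (𝓝 ((Ioi 0).indicator 1 t)) := by
    intro t
    rcases le_or_gt t 0 with h | h
    · refine tendsto_const_nhds.congr fun n => ?_
      rw [smoothPosPartDeriv_of_nonpos (mul_nonpos_of_nonneg_of_nonpos n.cast_nonneg h)]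
      simp [h]
    · refine tendsto_const_nhds.congr' ?_
      filter_upwards [hev t h] with n hn
      rw [smoothPosPartDeriv_of_one_lt hn]
      simp [h]
  have hind : {x | 0 < V x}.indicator G = fun x =>
      (Ioi (0 : ℝ)).indicator (1 : ℝ → ℝ) (V x) • G x := by
    ext1 x
    by_cases h : 0 < V x <;> simp [h]
  have hm : AEStronglyMeasurable (fun x => (Ioi (0 : ℝ)).indicator (1 : ℝ → ℝ) (V x))
      (surfaceArea S) :=
    ((measurable_one.indicator measurableSet_Ioi).comp_aemeasurable hV1.1.aemeasurable)
      |>.aestronglyMeasurable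
  have hmk : ∀ n : ℕ, AEStronglyMeasurable (fun x => smoothPosPartDeriv (n * V x))
      (surfaceArea S) := fun n =>
    (continuous_smoothPosPartDeriv.comp
      (continuous_const.mul continuous_id)).comp_aestronglyMeasurable hV1.1
  have hb : ∀ x, ‖(Ioi (0 : ℝ)).indicator (1 : ℝ → ℝ) (V x)‖ ≤ 1 := fun x => by
    by_cases h : 0 < V x <;> simp [h]
  have hpos : MemLp (fun x => max (V x) 0) 2 (surfaceArea S) := hV1.pos_part
  rw [hind]
  have hK : MemLp (fun x => (Ioi (0 : ℝ)).indicator (1 : ℝ → ℝ) (V x) • G x) 2 (surfaceArea S) := by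
    have hm' : AEStronglyMeasurable (fun x => (Ioi (0 : ℝ)).indicator (1 : ℝ → ℝ) (V x) • G x)
      (surfaceArea S) := hm.smul hG.1
    refine hG.of_le hm' (Eventually.of_forall fun x => ?_)
    rw [norm_smul]
    exact mul_le_of_le_one_left (norm_nonneg _) (hb x)
  refine hS.hasSobolevGradient_of_tendsto hsm hpos hK ?_ ?_
  · have hmV : ∀ n : ℕ, AEStronglyMeasurable
        (fun x => V x * Real.smoothTransition (n * V x) - max (V x) 0) (surfaceArea S) :=
      fun n => (hsm n).1.1.sub hpos.1
    refine tendsto_eLpNorm_two_of_dominated hmV hV1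
      (fun n => Eventually.of_forall fun x => ?_) (Eventually.of_forall fun x => hlim1 (V x))
    have h0 := Real.smoothTransition.nonneg (n * V x)
    have h1 := Real.smoothTransition.le_one (n * V x)
    rcases le_or_gt (V x) 0 with h | h
    · rw [Real.smoothTransition.zero_of_nonpos (mul_nonpos_of_nonneg_of_nonpos n.cast_nonneg h),
        max_eq_right h]
      simp
    · rw [max_eq_left h.le, Real.norm_eq_abs, Real.norm_eq_abs, abs_of_pos h, abs_le]
      constructor <;> nlinarith
  · have hmax1 : ∀ (n : ℕ) (x : S), ‖smoothPosPartDeriv (n * V x)‖ ≤ (max C 1 : NNReal) :=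
      fun n x => le_trans (hC _) (NNReal.coe_le_coe.2 (le_max_left _ _))
    have hmax2 : ∀ x, ‖(Ioi (0 : ℝ)).indicator (1 : ℝ → ℝ) (V x)‖ ≤ (max C 1 : NNReal) :=
      fun x => (hb x).trans (by simp)
    exact tendsto_eLpNorm_two_smul_sub (F := fun _ => G) hmk hm (fun _ => hG.1) hG hmax1 hmax2
      (Eventually.of_forall fun x => hlim2 (V x)) (by simp)

/-! ### A Poincaré inequality on convex open sets. -/

section Poincare

variable {E : Type*} [NormedAddCommGroup E] [NormedSpace ℝ E]

theorem Convex.enorm_sub_le_lintegral_fderiv {B : Set E} (hB : Convex ℝ B) (hBo : IsOpen B)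
    {u : E → ℝ} (hu : ContDiffOn ℝ 1 u B) {x y : E} (hx : x ∈ B) (hy : y ∈ B) :
    ‖u y - u x‖ₑ ≤ ∫⁻ t in Ioc (0 : ℝ) 1, ‖fderiv ℝ u (x + t • (y - x))‖ₑ * ‖y - x‖ₑ := by
  have hmem : ∀ t ∈ Icc (0 : ℝ) 1, x + t • (y - x) ∈ B := fun t ht =>
    hB.add_smul_sub_mem hx hy ht
  have hder : ∀ t ∈ Icc (0 : ℝ) 1, HasDerivAt (fun t : ℝ => u (x + t • (y - x)))
      (fderiv ℝ u (x + t • (y - x)) (y - x)) t := by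
    intro t ht
    have h1 : HasDerivAt (fun t : ℝ => x + t • (y - x)) (y - x) t := by
      simpa using ((hasDerivAt_id t).smul_const (y - x)).const_add x
    have h2 : DifferentiableAt ℝ u (x + t • (y - x)) :=
      (hu.contDiffAt (hBo.mem_nhds (hmem t ht))).differentiableAt (by simp)
    exact h2.hasFDerivAt.comp_hasDerivAt t h1
  have hcont : ContinuousOn (fun t : ℝ => fderiv ℝ u (x + t • (y - x)) (y - x)) (Icc 0 1) := by
    have h1 : ContinuousOn (fun t : ℝ => fderiv ℝ u (x + t • (y - x))) (Icc 0 1) :=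
      (hu.continuousOn_fderiv_of_isOpen hBo (by simp)).comp (by fun_prop) hmem
    exact h1.clm_apply continuousOn_const
  have hint : IntervalIntegrable (fun t : ℝ => fderiv ℝ u (x + t • (y - x)) (y - x)) volume 0 1 :=
    ContinuousOn.intervalIntegrable (by rwa [uIcc_of_le zero_le_one])
  have hFTC := intervalIntegral.integral_eq_sub_of_hasDerivAt
    (f := fun t : ℝ => u (x + t • (y - x)))
    (fun t ht => hder t (by rwa [uIcc_of_le zero_le_one] at ht)) hint
  simp only [one_smul, zero_smul, add_zero, add_sub_cancel] at hFTC
  rw [← hFTC, intervalIntegral.integral_of_le zero_le_one]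
  refine (enorm_integral_le_lintegral_enorm _).trans (lintegral_mono fun t => ?_)
  exact ContinuousLinearMap.le_opENorm _ _

variable [FiniteDimensional ℝ E] [MeasurableSpace E] [BorelSpace E] (μ : Measure E)
  [μ.IsAddHaarMeasure]

/-- The map contracts by 1 - s ≥ 1/2 and sends `B` into itself, so the change of variables costs at
most 2 to the dimension. -/
theorem Convex.lintegral_comp_contraction_le {B : Set E} (hB : Convex ℝ B) (hBo : IsOpen B)
    {f : E → ENNReal} (hf : Measurable f) {y : E} (hy : y ∈ B) {s : ℝ}
    (hs : s ∈ Icc (0 : ℝ) (1 / 2)) :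
    ∫⁻ x in B, f (x + s • (y - x)) ∂μ ≤ 2 ^ Module.finrank ℝ E * ∫⁻ x in B, f x ∂μ := by
  have hs1 : (1 - s) ≠ 0 := by linarith [hs.2]
  have hm : Measurable (B.indicator f) := hf.indicator hBo.measurableSet
  have h1 : ∫⁻ x in B, f (x + s • (y - x)) ∂μ
      ≤ ∫⁻ x, B.indicator f ((1 - s) • x + s • y) ∂μ := by
    rw [← lintegral_indicator hBo.measurableSet]
    refine lintegral_mono fun x => ?_
    by_cases hx : x ∈ B
    · have h2 : x + s • (y - x) ∈ B :=
        hB.add_smul_sub_mem hx hy ⟨hs.1, by linarith [hs.2]⟩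
      have h3 : (1 - s) • x + s • y = x + s • (y - x) := by module
      simp only [h3]
      rw [indicator_of_mem hx, indicator_of_mem h2]
    · simp [hx]
  have h2 : ∫⁻ x, B.indicator f ((1 - s) • x + s • y) ∂μ
      = ENNReal.ofReal |((1 - s) ^ Module.finrank ℝ E)⁻¹| * ∫⁻ x in B, f x ∂μ := by
    have := lintegral_map (μ := μ) (hm.comp (measurable_id.add_const (s • y)))
      (measurable_const_smul (1 - s) (α := E))
    simp only [Function.comp, id] at this
    rw [← this, Measure.map_addHaar_smul μ hs1, lintegral_smul_measure,
      lintegral_add_right_eq_self, lintegral_indicator hBo.measurableSet, smul_eq_mul]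
  refine h1.trans (h2.trans_le ?_)
  gcongr
  rw [abs_of_nonneg (by have : 0 ≤ 1 - s := by linarith [hs.2]
                        positivity), ← inv_pow, ENNReal.ofReal_pow (by
      have : 0 ≤ 1 - s := by linarith [hs.2]
      positivity)]
  gcongr
  rw [← ENNReal.ofReal_ofNat]
  apply ENNReal.ofReal_le_ofReal
  rw [inv_le_comm₀ (by linarith [hs.2]) (by norm_num)]
  linarith [hs.2]

/-- Stopping at the midpoint keeps the contraction parameter t/2 at most 1/2, where the Jacobian
factor stays bounded. -/
theorem Convex.lintegral_enorm_sub_midpoint_le {B : Set E} (hB : Convex ℝ B) (hBo : IsOpen B)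
    {u : E → ℝ} (hu : ContDiffOn ℝ 1 u B) {y : E} (hy : y ∈ B) :
    ∫⁻ x in B, ‖u (midpoint ℝ x y) - u x‖ₑ ∂μ
      ≤ 2 ^ Module.finrank ℝ E * (Metric.ediam B * ∫⁻ x in B, ‖fderiv ℝ u x‖ₑ ∂μ) := by
  have hm : Measurable fun x => ‖fderiv ℝ u x‖ₑ := (measurable_fderiv ℝ u).enorm
  have h1 : ∀ x ∈ B, ‖u (midpoint ℝ x y) - u x‖ₑ
      ≤ ∫⁻ t in Ioc (0 : ℝ) 1, ‖fderiv ℝ u (x + (t / 2) • (y - x))‖ₑ * Metric.ediam B := by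
    intro x hx
    have hmid : midpoint ℝ x y ∈ B := hB.midpoint_mem hx hy
    refine (hB.enorm_sub_le_lintegral_fderiv hBo hu hx hmid).trans (lintegral_mono fun t => ?_)
    have h2 : x + t • (midpoint ℝ x y - x) = x + (t / 2) • (y - x) := by
      rw [midpoint_eq_smul_add, invOf_eq_inv]
      module
    simp only [h2]
    gcongr
    rw [← edist_eq_enorm_sub]
    exact Metric.edist_le_ediam_of_mem hmid hx
  have hmeas : Measurable fun p : E × ℝ => ‖fderiv ℝ u (p.1 + (p.2 / 2) • (y - p.1))‖ₑ :=
    hm.comp (by fun_prop)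
  calc ∫⁻ x in B, ‖u (midpoint ℝ x y) - u x‖ₑ ∂μ
      ≤ ∫⁻ x in B, (∫⁻ t in Ioc (0 : ℝ) 1,
          ‖fderiv ℝ u (x + (t / 2) • (y - x))‖ₑ * Metric.ediam B) ∂μ :=
        setLIntegral_mono' hBo.measurableSet h1
    _ = ∫⁻ t in Ioc (0 : ℝ) 1, (∫⁻ x in B,
          ‖fderiv ℝ u (x + (t / 2) • (y - x))‖ₑ * Metric.ediam B ∂μ) :=
        lintegral_lintegral_swap (hmeas.mul_const _).aemeasurable
    _ ≤ ∫⁻ t in Ioc (0 : ℝ) 1, 2 ^ Module.finrank ℝ E *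
          (Metric.ediam B * ∫⁻ x in B, ‖fderiv ℝ u x‖ₑ ∂μ) := by
        refine setLIntegral_mono' measurableSet_Ioc fun t ht => ?_
        have hmt : Measurable fun x : E => ‖fderiv ℝ u (x + (t / 2) • (y - x))‖ₑ :=
          hm.comp (by fun_prop)
        rw [lintegral_mul_const _ hmt,
          mul_comm, mul_left_comm]
        gcongr
        exact hB.lintegral_comp_contraction_le μ hBo hm hy ⟨by linarith [ht.1], by linarith [ht.2]⟩
    _ = _ := by simp

theorem Convex.lintegral_prod_enorm_sub_le {B : Set E} (hB : Convex ℝ B) (hBo : IsOpen B)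
    {u : E → ℝ} (hu : ContDiffOn ℝ 1 u B) :
    ∫⁻ p, ‖u p.1 - u p.2‖ₑ ∂((μ.restrict B).prod (μ.restrict B))
      ≤ 2 * (2 ^ Module.finrank ℝ E * (Metric.ediam B * ∫⁻ x in B, ‖fderiv ℝ u x‖ₑ ∂μ) * μ B) := by
  set ν := (μ.restrict B).prod (μ.restrict B) with hν
  set F : E × E → ENNReal := fun p => ‖u (midpoint ℝ p.1 p.2) - u p.1‖ₑ with hF
  have hm : AEMeasurable F ν := by
    rw [hν, Measure.prod_restrict]
    refine ContinuousOn.aemeasurable ?_ (hBo.prod hBo).measurableSet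
    have h1 : ContinuousOn (fun p : E × E => u (midpoint ℝ p.1 p.2)) (B ×ˢ B) := by
      refine hu.continuousOn.comp (Continuous.continuousOn ?_)
        fun p hp => hB.midpoint_mem hp.1 hp.2
      simp only [midpoint_eq_smul_add]
      fun_prop
    have h2 : ContinuousOn (fun p : E × E => u p.1) (B ×ˢ B) :=
      hu.continuousOn.comp continuousOn_fst fun p hp => hp.1
    exact (h1.sub h2).enorm
  have key : ∫⁻ p, F p ∂ν
      ≤ 2 ^ Module.finrank ℝ E * (Metric.ediam B * ∫⁻ x in B, ‖fderiv ℝ u x‖ₑ ∂μ) * μ B := by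
    rw [← setLIntegral_const, lintegral_prod_symm F hm]
    exact setLIntegral_mono' hBo.measurableSet fun y hy =>
      hB.lintegral_enorm_sub_midpoint_le μ hBo hu hy
  -- Pass through the midpoint; the two halves are interchanged by swapping the variables.
  calc ∫⁻ p, ‖u p.1 - u p.2‖ₑ ∂ν
      ≤ ∫⁻ p, (F p + F p.swap) ∂ν := by
        refine lintegral_mono fun p => ?_
        simp only [hF, Prod.fst_swap, Prod.snd_swap]
        rw [midpoint_comm p.2 p.1, ← edist_eq_enorm_sub, ← edist_eq_enorm_sub,
          ← edist_eq_enorm_sub, edist_comm _ (u p.1)]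
        exact edist_triangle _ _ _
    _ = 2 * ∫⁻ p, F p ∂ν := by
        rw [lintegral_add_left' hm, lintegral_prod_swap, two_mul]
    _ ≤ _ := by gcongr

end Poincare

/-! ### Functions with zero gradient are constant. -/

theorem MeasureTheory.lintegral_prod_add_fst_snd {α : Type*} [MeasurableSpace α] {μ : Measure α}
    [SFinite μ] {h : α → ENNReal} (hh : AEMeasurable h μ) :
    ∫⁻ p, (h p.1 + h p.2) ∂(μ.prod μ) = 2 * (μ univ * ∫⁻ x, h x ∂μ) := by
  rw [lintegral_add_left' hh.comp_fst, lintegral_prod _ hh.comp_fst, lintegral_prod _ hh.comp_snd]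
  simp only [lintegral_const]
  rw [lintegral_mul_const'' _ hh, mul_comm, two_mul, mul_comm (μ univ)]

theorem surfaceGradient_inner {S : Set Space} {φ : Space → ℝ} {p w : Space}
    (hw : w ∈ surfaceTangent S p) :
    inner ℝ (surfaceGradient S φ p) w = inner ℝ (gradient φ p) w := by
  rw [surfaceGradient, Submodule.inner_starProjection_left_eq_right,
    Submodule.starProjection_eq_self_iff.2 hw]

namespace SurfaceChart

variable {S : Set Space} (c : SurfaceChart S)

theorem norm_fderiv_le {v : Plane} (hv : v ∈ c.disc) : ‖fderiv ℝ c.param v‖ ≤ c.lip := by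
  have h : LipschitzOnWith c.lip c.param c.disc := by
    intro a ha b hb
    have := c.lipschitzOn ha hb
    rwa [Subtype.edist_eq, c.coe_lift a ha, c.coe_lift b hb] at this
  exact norm_fderiv_le_of_lipschitzOn ℝ (c.isOpen_disc.mem_nhds hv) h

/-- The derivative of the parametrization takes tangent values, so only the tangential part of ∇φ
contributes. -/
theorem norm_fderiv_comp_le {φ : Space → ℝ} (hφ : ContDiff ℝ ∞ φ) {v : Plane} (hv : v ∈ c.disc) :
    ‖fderiv ℝ (fun w => φ (c.param w)) v‖ ≤ c.lip * ‖surfaceGradient S φ (c.lift v)‖ := by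
  have h1 : HasFDerivAt (fun w => φ (c.param w))
      ((fderiv ℝ φ (c.param v)).comp (fderiv ℝ c.param v)) v :=
    (hφ.differentiable (by simp) _).hasFDerivAt.comp v (c.hasFDerivAt hv)
  rw [h1.fderiv]
  refine ContinuousLinearMap.opNorm_le_bound _ (by positivity) fun w => ?_
  have h2 : (fderiv ℝ φ (c.param v)) (fderiv ℝ c.param v w)
      = inner ℝ (surfaceGradient S φ (c.lift v)) (fderiv ℝ c.param v w) := by
    rw [c.coe_lift v hv, surfaceGradient_inner (c.fderiv_mem_surfaceTangent hv w), gradient,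
      InnerProductSpace.toDual_symm_apply]
  rw [ContinuousLinearMap.comp_apply, h2, mul_comm (c.lip : ℝ), mul_assoc]
  refine (norm_inner_le_norm _ _).trans ?_
  gcongr
  exact (ContinuousLinearMap.le_opNorm _ _).trans (by gcongr; exact c.norm_fderiv_le hv)

end SurfaceChart

namespace IsRegularSurface

variable {S : Set Space} (hS : IsRegularSurface S) [CompactSpace S]
include hS

theorem tendsto_lintegral_enorm {E : Type*} [NormedAddCommGroup E] {F : ℕ → S → E}
    (hF : ∀ n, AEStronglyMeasurable (F n) (surfaceArea S))
    (h : Tendsto (fun n => eLpNorm (F n) 2 (surfaceArea S)) atTop (𝓝 0)) :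
    Tendsto (fun n => ∫⁻ x, ‖F n x‖ₑ ∂surfaceArea S) atTop (𝓝 0) := by
  have := hS.isFiniteMeasure_surfaceArea
  set C : ENNReal :=
    surfaceArea S univ ^ (1 / (1 : ENNReal).toReal - 1 / (2 : ENNReal).toReal) with hC
  have hC' : C ≠ ⊤ := ENNReal.rpow_ne_top_of_nonneg (by norm_num) (measure_ne_top _ _)
  have h1 := ENNReal.Tendsto.mul_const (b := C) h (Or.inr hC')
  rw [zero_mul] at h1
  have key : ∀ n, ∫⁻ x, ‖F n x‖ₑ ∂surfaceArea S ≤ eLpNorm (F n) 2 (surfaceArea S) * C := by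
    intro n
    rw [← eLpNorm_one_eq_lintegral_enorm]
    exact eLpNorm_le_eLpNorm_mul_rpow_measure_univ (by norm_num) (hF n)
  exact tendsto_of_tendsto_of_tendsto_of_le_of_le tendsto_const_nhds h1 (fun _ => zero_le) key

theorem lintegral_prod_chart_eq_zero (c : SurfaceChart S) {V : S → ℝ}
    (hV : HasSobolevGradient S V fun _ => 0) :
    ∫⁻ p, ‖V (c.lift p.1) - V (c.lift p.2)‖ₑ
      ∂((volume.restrict c.disc).prod (volume.restrict c.disc)) = 0 := by
  obtain ⟨hV1, -, φ, hφ, h1, h2⟩ := hV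
  simp only [sub_zero] at h2
  have hm1 : ∀ n, AEStronglyMeasurable (fun x : S => φ n x - V x) (surfaceArea S) :=
    fun n => (hS.memLp_smooth (hφ n)).1.sub hV1.1
  have hm2 : ∀ n, AEStronglyMeasurable (fun x : S => surfaceGradient S (φ n) x) (surfaceArea S) :=
    fun n => (hS.memLp_surfaceGradient (hφ n)).1
  have hd : volume c.disc ≠ ⊤ := Metric.isBounded_ball.measure_lt_top.ne
  have he : Metric.ediam c.disc ≠ ⊤ := Metric.isBounded_ball.ediam_ne_top
  have hK : (c.antilip : ENNReal) ^ 2 ≠ ⊤ := ENNReal.pow_ne_top ENNReal.coe_ne_top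
  -- `A` bounds the cost of replacing V by φₙ at both points; `D` is the Poincaré constant of the
  -- disc times the chart distortion. Both accompanying integrals tend to 0.
  set A : ENNReal := 2 * (volume c.disc * c.antilip ^ 2) with hA
  set D : ENNReal := 2 * (2 ^ Module.finrank ℝ Plane * (Metric.ediam c.disc *
    (c.lip * c.antilip ^ 2)) * volume c.disc) with hD
  have key : ∀ n, ∫⁻ p, ‖V (c.lift p.1) - V (c.lift p.2)‖ₑ
      ∂((volume.restrict c.disc).prod (volume.restrict c.disc))
      ≤ A * ∫⁻ x : S, ‖φ n x - V x‖ₑ ∂surfaceArea S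
        + D * ∫⁻ x : S, ‖surfaceGradient S (φ n) x‖ₑ ∂surfaceArea S := by
    intro n
    have hh : AEMeasurable (fun v => ‖φ n (c.lift v) - V (c.lift v)‖ₑ)
        (volume.restrict c.disc) := by
      have h3 : AEMeasurable (fun x : S => ‖φ n x - V x‖ₑ)
          ((volume.restrict c.disc).map c.lift) :=
        ((hm1 n).enorm.smul_measure _).mono_measure c.map_volume_le
      exact h3.comp_aemeasurable c.aemeasurable_lift
    have hP : ∫⁻ p, ‖φ n (c.param p.1) - φ n (c.param p.2)‖ₑ
        ∂((volume.restrict c.disc).prod (volume.restrict c.disc))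
        ≤ D * ∫⁻ x : S, ‖surfaceGradient S (φ n) x‖ₑ ∂surfaceArea S := by
      have hc : ContDiffOn ℝ 1 (fun w => φ n (c.param w)) c.disc :=
        ((hφ n).of_le (by simp)).comp_contDiffOn (c.contDiffOn.of_le (by simp))
      refine ((convex_ball c.center c.radius).lintegral_prod_enorm_sub_le volume c.isOpen_disc
        hc).trans ?_
      have h4 : ∫⁻ v in c.disc, ‖fderiv ℝ (fun w => φ n (c.param w)) v‖ₑ
          ≤ c.lip * (c.antilip ^ 2 * ∫⁻ x : S, ‖surfaceGradient S (φ n) x‖ₑ ∂surfaceArea S) := by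
        rw [← ENNReal.coe_pow]
        refine le_trans ?_ (mul_le_mul_right (c.lintegral_comp_le (hm2 n).enorm) _)
        rw [← lintegral_const_mul' _ _ ENNReal.coe_ne_top]
        refine setLIntegral_mono' c.isOpen_disc.measurableSet fun v hv => ?_
        have h5 := c.norm_fderiv_comp_le (hφ n) hv
        rw [← coe_nnnorm, ← coe_nnnorm, ← NNReal.coe_mul, NNReal.coe_le_coe] at h5
        rw [enorm_eq_nnnorm, enorm_eq_nnnorm]
        exact_mod_cast h5
      rw [hD]
      calc _ ≤ 2 * (2 ^ Module.finrank ℝ Plane * (Metric.ediam c.disc * (c.lip * (c.antilip ^ 2 *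
            ∫⁻ x : S, ‖surfaceGradient S (φ n) x‖ₑ ∂surfaceArea S))) * volume c.disc) := by
            gcongr _ * (_ * (_ * ?_) * ?_)
            · exact h4
            · exact le_rfl
        _ = _ := by ring
    have hsum : ∫⁻ p, (‖φ n (c.lift p.1) - V (c.lift p.1)‖ₑ + ‖φ n (c.lift p.2) - V (c.lift p.2)‖ₑ)
        ∂((volume.restrict c.disc).prod (volume.restrict c.disc))
        ≤ A * ∫⁻ x : S, ‖φ n x - V x‖ₑ ∂surfaceArea S := by
      rw [lintegral_prod_add_fst_snd hh, hA, Measure.restrict_apply_univ, mul_assoc, mul_assoc]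
      gcongr
      exact c.lintegral_comp_le (hm1 n).enorm
    refine le_trans ?_ (add_le_add hsum hP)
    have hhm : AEMeasurable (fun p : Plane × Plane => ‖φ n (c.lift p.1) - V (c.lift p.1)‖ₑ
        + ‖φ n (c.lift p.2) - V (c.lift p.2)‖ₑ)
        ((volume.restrict c.disc).prod (volume.restrict c.disc)) := hh.comp_fst.add hh.comp_snd
    rw [← lintegral_add_left' hhm, Measure.prod_restrict]
    refine setLIntegral_mono' (c.isOpen_disc.prod c.isOpen_disc).measurableSet fun p hp => ?_
    rw [← c.coe_lift _ hp.1, ← c.coe_lift _ hp.2]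
    simp only [← edist_eq_enorm_sub]
    rw [edist_comm (φ n (c.lift p.1)) (V (c.lift p.1)), add_right_comm]
    exact edist_triangle4 _ _ _ _
  have hlim : Tendsto (fun n => A * ∫⁻ x : S, ‖φ n x - V x‖ₑ ∂surfaceArea S
        + D * ∫⁻ x : S, ‖surfaceGradient S (φ n) x‖ₑ ∂surfaceArea S) atTop (𝓝 0) := by
    have hAt : A ≠ ⊤ := by finiteness
    have hDt : D ≠ ⊤ := by finiteness
    have h3 := ENNReal.Tendsto.const_mul (a := A) (hS.tendsto_lintegral_enorm hm1 h1) (Or.inr hAt)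
    have h4 := ENNReal.Tendsto.const_mul (a := D) (hS.tendsto_lintegral_enorm hm2 h2) (Or.inr hDt)
    simpa using h3.add h4
  exact le_antisymm (ge_of_tendsto' hlim key) zero_le

theorem exists_ae_eq_const_chart (c : SurfaceChart S) {V : S → ℝ}
    (hV : HasSobolevGradient S V fun _ => 0) :
    ∃ k, ∀ᵐ x ∂surfaceArea S, x ∈ c.lift '' c.disc → V x = k := by
  have hm : AEMeasurable (fun v => V (c.lift v)) (volume.restrict c.disc) := by
    have h3 : AEMeasurable V ((volume.restrict c.disc).map c.lift) :=
      (hV.1.1.aemeasurable.smul_measure _).mono_measure c.map_volume_le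
    exact h3.comp_aemeasurable c.aemeasurable_lift
  have h0 := hS.lintegral_prod_chart_eq_zero c hV
  have hm2 : AEMeasurable (fun p : Plane × Plane => ‖V (c.lift p.1) - V (c.lift p.2)‖ₑ)
      ((volume.restrict c.disc).prod (volume.restrict c.disc)) :=
    (hm.comp_fst.sub hm.comp_snd).enorm
  rw [lintegral_eq_zero_iff' hm2] at h0
  have h1 := Measure.ae_ae_of_ae_prod h0
  have hne : (ae (volume.restrict c.disc)).NeBot := by
    rw [ae_neBot, Ne, Measure.restrict_eq_zero]
    exact (c.isOpen_disc.measure_pos volume ⟨_, c.center_mem_disc⟩).ne'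
  -- By Fubini, some fixed `v` satisfies V(w) = V(v) for almost every w in the chart.
  obtain ⟨v, hv⟩ := h1.exists
  refine ⟨V (c.lift v), c.ae_image_of_ae ?_⟩
  filter_upwards [hv] with w hw
  simp only [Pi.zero_apply, enorm_eq_zero] at hw
  linarith

/-- The constants of overlapping charts agree because the overlap is open and nonempty, hence of
positive area; so they form a locally constant function on a connected space. -/
theorem exists_ae_eq_const [PreconnectedSpace S] [Nonempty S] {V : S → ℝ}
    (hV : HasSobolevGradient S V fun _ => 0) : ∃ k, ∀ᵐ x ∂surfaceArea S, V x = k := by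
  choose c hc using hS.exists_chart
  choose k hk using fun p => hS.exists_ae_eq_const_chart (c p) hV
  have hmem : ∀ p, (c p).lift '' (c p).disc ∈ 𝓝 p := fun p => by
    have := (c p).image_mem_nhds (c p).center_mem_disc
    rwa [hc] at this
  have hloc : IsLocallyConstant k := by
    rw [IsLocallyConstant.iff_eventually_eq]
    intro p
    filter_upwards [hmem p] with q hq
    by_contra hne
    refine surfaceArea_pos hS ((c p).isOpen_image.inter (c q).isOpen_image)
      ⟨q, hq, mem_of_mem_nhds (hmem q)⟩ ?_
    have := (hk p).and (hk q)
    refine measure_mono_null ?_ (ae_iff.1 this)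
    rintro x ⟨hxp, hxq⟩ ⟨h1, h2⟩
    exact hne ((h2 hxq).symm.trans (h1 hxp))
  obtain ⟨p⟩ := ‹Nonempty S›
  refine ⟨k p, ?_⟩
  rw [ae_iff]
  refine measure_null_of_locally_null _ fun x _ =>
    ⟨{y | ¬ (y ∈ (c x).lift '' (c x).disc → V y = k x)}, ?_, ae_iff.1 (hk x)⟩
  filter_upwards [self_mem_nhdsWithin, mem_nhdsWithin_of_mem_nhds (hmem x)] with y hy1 hy2 h
  exact hy1 ((h hy2).trans (hloc.apply_eq_of_preconnectedSpace x p))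

end IsRegularSurface

/-! ### Minimizers: first variation and change of sign. -/

/-- Take both signs of t, divide by |t| and let t → 0. -/
theorem eq_zero_of_forall_quadratic_nonneg {L Q t₀ : ℝ} (ht₀ : 0 < t₀)
    (h : ∀ t, |t| ≤ t₀ → 0 ≤ 2 * t * L + t ^ 2 * Q) : L = 0 := by
  have hlin : ∀ t, 0 < t → t ≤ t₀ → 2 * |L| ≤ t * |Q| := by
    intro t ht htt
    have h1 := h t (by rwa [abs_of_pos ht])
    have h2 := h (-t) (by rwa [abs_neg, abs_of_pos ht])
    have h3 : t * (2 * |L|) ≤ t * (t * |Q|) := by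
      rcases abs_cases L with ⟨e, -⟩ | ⟨e, -⟩ <;> rw [e] <;>
        nlinarith [mul_le_mul_of_nonneg_left (le_abs_self Q) (sq_nonneg t)]
    exact le_of_mul_le_mul_left h3 ht
  have hlim : Tendsto (fun t : ℝ => t * |Q|) (𝓝[>] 0) (𝓝 0) := by
    have : Tendsto (fun t : ℝ => t * |Q|) (𝓝 0) (𝓝 (0 * |Q|)) :=
      (continuous_id.mul continuous_const).tendsto 0
    rw [zero_mul] at this
    exact this.mono_left nhdsWithin_le_nhds
  have h0 : 2 * |L| ≤ 0 := by
    refine ge_of_tendsto hlim ?_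
    filter_upwards [Ioc_mem_nhdsGT ht₀] with t ht using hlin t ht.1 ht.2
  exact abs_nonpos_iff.1 (by linarith)

theorem MeasureTheory.MemLp.integrable_inner_two {α E : Type*} [MeasurableSpace α] {μ : Measure α}
    [NormedAddCommGroup E] [InnerProductSpace ℝ E] {u w : α → E} (hu : MemLp u 2 μ)
    (hw : MemLp w 2 μ) : Integrable (fun x => inner ℝ (u x) (w x)) μ := by
  refine (hu.norm.integrable_mul hw.norm).mono' (hu.1.inner hw.1)
    (Eventually.of_forall fun x => norm_inner_le_norm _ _)

theorem MeasureTheory.MemLp.eLpNorm_two_le_of_integral_sq_le {α E F : Type*} [MeasurableSpace α]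
    {μ : Measure α} [NormedAddCommGroup E] [NormedAddCommGroup F] {u : α → E} {w : α → F}
    (hu : MemLp u 2 μ) (hw : MemLp w 2 μ) (h : ∫ x, ‖u x‖ ^ 2 ∂μ ≤ ∫ x, ‖w x‖ ^ 2 ∂μ) :
    eLpNorm u 2 μ ≤ eLpNorm w 2 μ := by
  rw [hu.eLpNorm_eq_integral_rpow_norm (by norm_num) (by norm_num),
    hw.eLpNorm_eq_integral_rpow_norm (by norm_num) (by norm_num)]
  apply ENNReal.ofReal_le_ofReal
  simp only [ENNReal.toReal_ofNat, Real.rpow_two]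
  exact Real.rpow_le_rpow (integral_nonneg fun x => by positivity) h (by norm_num)

theorem IsSurfaceC1.continuous {S : Set Space} {H : S → ℝ} (hH : IsSurfaceC1 S H) :
    Continuous H := by
  obtain ⟨h, hh, he⟩ := hH
  have : H = fun x : S => h x := funext fun x => (he x).symm
  rw [this]
  exact hh.continuous.comp continuous_subtype_val

theorem IsRegularSurface.forall_le_of_ae_le {S : Set Space} (hS : IsRegularSurface S) {f g : S → ℝ}
    (hf : Continuous f) (hg : Continuous g) (h : ∀ᵐ x ∂surfaceArea S, f x ≤ g x) (x : S) :
    f x ≤ g x := by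
  by_contra! hx
  refine surfaceArea_pos hS (isOpen_lt hg hf) ⟨x, hx⟩ ?_
  refine measure_mono_null (fun y hy => ?_) (ae_iff.1 h)
  exact not_le.2 hy

/-- `V` is admissible for the obstacle problem and `G` is its gradient. -/
def IsObstacleAdmissible (S : Set Space) (β : ℝ) (V : S → ℝ) (G : S → Space) : Prop :=
  HasSobolevGradient S V G ∧ ∀ᵐ x ∂surfaceArea S, |V x| ≤ β / 2

/-- `V`, with gradient `G`, minimizes the energy among the admissible functions. -/
def IsObstacleMinimizer (S : Set Space) (H : S → ℝ) (β : ℝ) (V : S → ℝ) (G : S → Space) : Prop :=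
  IsObstacleAdmissible S β V G ∧ ∀ W K, IsObstacleAdmissible S β W K →
    obstacleEnergy S H V G ≤ obstacleEnergy S H W K

theorem IsObstacleSolution.exists_isObstacleMinimizer {S : Set Space} {H V : S → ℝ} {β : ℝ}
    (h : IsObstacleSolution S H β V) : ∃ G, IsObstacleMinimizer S H β V G := by
  obtain ⟨G, h1, h2, h3⟩ := h
  exact ⟨G, ⟨h1, h2⟩, fun W K hW => h3 W K hW.1 hW.2⟩

section Neg

variable {S : Set Space} {H V : S → ℝ} {G : S → Space} {β : ℝ}

theorem obstacleEnergy_neg : obstacleEnergy S (-H) (-V) (-G) = obstacleEnergy S H V G := by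
  simp [obstacleEnergy]

theorem HasSobolevGradient.neg (h : HasSobolevGradient S V G) : HasSobolevGradient S (-V) (-G) :=
  (h.const_mul (-1)).congr (by simp [Pi.neg_def]) (by simp [Pi.neg_def])

theorem IsObstacleAdmissible.neg (h : IsObstacleAdmissible S β V G) :
    IsObstacleAdmissible S β (-V) (-G) :=
  ⟨h.1.neg, by simpa using h.2⟩

theorem IsObstacleMinimizer.neg (h : IsObstacleMinimizer S H β V G) :
    IsObstacleMinimizer S (-H) β (-V) (-G) := by
  refine ⟨h.1.neg, fun W K hW => ?_⟩
  rw [obstacleEnergy_neg, ← obstacleEnergy_neg (H := -H), neg_neg]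
  exact h.2 _ _ hW.neg

theorem HasSurfaceLaplacian.neg {f : S → ℝ} (h : HasSurfaceLaplacian S f H) :
    HasSurfaceLaplacian S (-f) (-H) := by
  obtain ⟨G, hG, h⟩ := h
  refine ⟨-G, hG.neg, fun φ hφ => ?_⟩
  simp only [Pi.neg_apply, inner_neg_left, neg_mul, integral_neg, h φ hφ]

end Neg

/-! ### Comparison of minimizers. -/

namespace IsRegularSurface

variable {S : Set Space} (hS : IsRegularSurface S) [CompactSpace S] {H V W : S → ℝ}
  {G K : S → Space} {β : ℝ}
include hS

theorem integrable_energy (hH : Continuous H) (hV : HasSobolevGradient S V G) :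
    Integrable (fun x => ‖G x‖ ^ 2 + 2 * H x * V x) (surfaceArea S) := by
  have h1 : Integrable (fun x => ‖G x‖ ^ 2) (surfaceArea S) :=
    hV.2.1.integrable_norm_pow (by norm_num)
  have h2 : Integrable (fun x => H x * V x) (surfaceArea S) :=
    (hS.memLp_of_continuous hH 2).integrable_mul hV.1
  simpa [mul_assoc] using h1.fun_add (h2.const_mul 2)

/-- Two minimizers of the obstacle problem have the same gradient. -/
theorem gradient_ae_eq_of_energy_le (hH : Continuous H) (hV : IsObstacleMinimizer S H β V G)
    (hW : IsObstacleAdmissible S β W K) (hle : obstacleEnergy S H W K ≤ obstacleEnergy S H V G) :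
    ∀ᵐ x ∂surfaceArea S, K x - G x = 0 := by
  have hadm : IsObstacleAdmissible S β (fun x => (1 / 2) * (V x + W x))
      (fun x => (1 / 2 : ℝ) • (G x + K x)) := by
    refine ⟨(hS.hasSobolevGradient_add hV.1.1 hW.1).const_mul _, ?_⟩
    filter_upwards [hV.1.2, hW.2] with x h1 h2
    rw [abs_le] at *
    constructor <;> linarith
  have h1 := hV.2 _ _ hadm
  have hi1 := hS.integrable_energy hH hV.1.1
  have hi2 := hS.integrable_energy hH hW.1
  have hsub : MemLp (fun x => K x - G x) 2 (surfaceArea S) := hW.1.2.1.sub hV.1.1.2.1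
  have hi3 : Integrable (fun x => ‖K x - G x‖ ^ 2) (surfaceArea S) :=
    hsub.integrable_norm_pow (by norm_num)
  -- Parallelogram law: the average of the two functions lies below the mean energy by a quarter of
  -- the squared gradient difference.
  have heq : obstacleEnergy S H (fun x => (1 / 2) * (V x + W x))
      (fun x => (1 / 2 : ℝ) • (G x + K x)) = (1 / 2) * (obstacleEnergy S H V G +
        obstacleEnergy S H W K) - (1 / 4) * ∫ x, ‖K x - G x‖ ^ 2 ∂surfaceArea S := by
    simp only [obstacleEnergy]
    rw [← integral_add hi1 hi2, ← integral_const_mul, ← integral_const_mul,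
      ← integral_sub ((hi1.fun_add hi2).const_mul _) (hi3.const_mul _)]
    refine integral_congr_ae (Eventually.of_forall fun x => ?_)
    have hp := parallelogram_law_with_norm ℝ (G x) (K x)
    simp only [norm_smul, mul_pow]
    rw [norm_sub_rev (K x)]
    norm_num
    linarith
  have h0 : ∫ x, ‖K x - G x‖ ^ 2 ∂surfaceArea S = 0 :=
    le_antisymm (by linarith) (integral_nonneg fun x => by positivity)
  rw [integral_eq_zero_iff_of_nonneg (fun x => by positivity) hi3] at h0
  filter_upwards [h0] with x hx
  simpa using hx

/-- If a minimizer can be shifted upwards by a positive constant without leaving the constraint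
set, then it differs from `f` by a function with zero gradient. -/
theorem gradient_ae_eq_of_interior (hH : Continuous H) {f : S → ℝ} {Gf : S → Space}
    (hf : HasSobolevGradient S f Gf)
    (hfH : ∀ φ : Space → ℝ, ContDiff ℝ ∞ φ →
      ∫ x : S, inner ℝ (Gf x) (surfaceGradient S φ x) ∂(surfaceArea S)
        = - ∫ x : S, H x * φ x ∂(surfaceArea S))
    (hV : IsObstacleMinimizer S H β V G) {k : ℝ} (hk : 0 < k)
    (hVk : ∀ᵐ x ∂surfaceArea S, V x + k ≤ β / 2) :
    ∀ᵐ x ∂surfaceArea S, G x - Gf x = 0 := by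
  -- Adding a constant to V therefore costs no energy.
  have hHint : ∫ x : S, H x ∂surfaceArea S = 0 := by
    have := hfH (fun _ => 1) contDiff_const
    simpa [surfaceGradient_const] using this
  have hμ := hS.isFiniteMeasure_surfaceArea
  have hH2 := hS.memLp_of_continuous hH 2
  have hweak : ∀ φ : Space → ℝ, ContDiff ℝ ∞ φ →
      ∫ x : S, inner ℝ (G x) (surfaceGradient S φ x) ∂(surfaceArea S)
        + ∫ x : S, H x * φ x ∂(surfaceArea S) = 0 := by
    intro φ hφ
    obtain ⟨M, hM⟩ := isCompact_univ.exists_bound_of_continuousOn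
      (f := fun x : S => φ x) (hφ.continuous.comp continuous_subtype_val).continuousOn
    have hi0 := hS.integrable_energy hH hV.1.1
    have hiH : Integrable H (surfaceArea S) := hH2.integrable (by norm_num)
    have hiG : Integrable (fun x : S => inner ℝ (G x) (surfaceGradient S φ x)) (surfaceArea S) :=
      hV.1.1.2.1.integrable_inner_two (hS.memLp_surfaceGradient hφ)
    have hiHφ : Integrable (fun x : S => H x * φ x) (surfaceArea S) :=
      hH2.integrable_mul (hS.memLp_smooth hφ)
    have hiQ : Integrable (fun x : S => ‖surfaceGradient S φ x‖ ^ 2) (surfaceArea S) :=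
      (hS.memLp_surfaceGradient hφ).integrable_norm_pow (by norm_num)
    have hM1 : 0 < |M| + 1 := by positivity
    -- This `t₀` ensures |tφ| ≤ k/2. The shift by k/2 leaves exactly that much room below the upper
    -- obstacle and above the lower one.
    refine eq_zero_of_forall_quadratic_nonneg (t₀ := k / 2 / (|M| + 1))
      (Q := ∫ x : S, ‖surfaceGradient S φ x‖ ^ 2 ∂surfaceArea S) (by positivity) fun t ht => ?_
    have hadm : IsObstacleAdmissible S β (fun x => V x + (k / 2 + t * φ x))
        (fun x => G x + t • surfaceGradient S φ x) := by
      have h1 := hS.hasSobolevGradient_add (hS.hasSobolevGradient_const (k / 2))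
        ((hS.hasSobolevGradient_smooth hφ).const_mul t)
      simp only [zero_add] at h1
      refine ⟨hS.hasSobolevGradient_add hV.1.1 h1, ?_⟩
      filter_upwards [hV.1.2, hVk] with x hx1 hx2
      have h2 : |t * φ x| ≤ k / 2 := by
        rw [abs_mul]
        calc |t| * |φ x| ≤ k / 2 / (|M| + 1) * (|M| + 1) := by
              gcongr
              exact (hM x trivial).trans ((le_abs_self M).trans (by linarith))
          _ = k / 2 := by field_simp
      rw [abs_le] at *
      constructor <;> linarith
    have hmin := hV.2 _ _ hadm
    have heq : obstacleEnergy S H (fun x => V x + (k / 2 + t * φ x))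
        (fun x => G x + t • surfaceGradient S φ x) = obstacleEnergy S H V G
          + (k * ∫ x, H x ∂surfaceArea S
          + (2 * t * (∫ x : S, inner ℝ (G x) (surfaceGradient S φ x) ∂(surfaceArea S)
            + ∫ x : S, H x * φ x ∂(surfaceArea S))
          + t ^ 2 * ∫ x : S, ‖surfaceGradient S φ x‖ ^ 2 ∂surfaceArea S)) := by
      simp only [obstacleEnergy]
      rw [← integral_add hiG hiHφ, ← integral_const_mul, ← integral_const_mul, ← integral_const_mul,
        ← integral_add ((hiG.fun_add hiHφ).const_mul _) (hiQ.const_mul _),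
        ← integral_add (hiH.const_mul _)
          (((hiG.fun_add hiHφ).const_mul _).fun_add (hiQ.const_mul _)),
        ← integral_add hi0 ((hiH.const_mul _).fun_add
          (((hiG.fun_add hiHφ).const_mul _).fun_add (hiQ.const_mul _)))]
      refine integral_congr_ae (Eventually.of_forall fun x => ?_)
      simp only [norm_add_sq_real, inner_smul_right, norm_smul, mul_pow, Real.norm_eq_abs, sq_abs]
      ring
    rw [heq, hHint] at hmin
    linarith
  have horth : ∀ φ : Space → ℝ, ContDiff ℝ ∞ φ →
      ∫ x : S, inner ℝ (G x - Gf x) (surfaceGradient S φ x) ∂(surfaceArea S) = 0 := by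
    intro φ hφ
    have hg := hS.memLp_surfaceGradient hφ
    simp only [inner_sub_left]
    rw [integral_sub (hV.1.1.2.1.integrable_inner_two hg) (hf.2.1.integrable_inner_two hg),
      hfH φ hφ]
    linarith [hweak φ hφ]
  -- The field G - Gf is orthogonal to every smooth gradient and is an L² limit of such gradients,
  -- so Pythagoras bounds its norm by errors tending to 0.
  obtain ⟨-, hD, φ, hφ, -, hlim⟩ := hS.hasSobolevGradient_sub hV.1.1 hf
  have hle : ∀ n, eLpNorm (fun x => G x - Gf x) 2 (surfaceArea S)
      ≤ eLpNorm (fun x : S => surfaceGradient S (φ n) x - (G x - Gf x)) 2 (surfaceArea S) := by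
    intro n
    have hg := hS.memLp_surfaceGradient (hφ n)
    refine hD.eLpNorm_two_le_of_integral_sq_le (hg.sub hD) ?_
    have hi1 : Integrable (fun x : S => ‖surfaceGradient S (φ n) x‖ ^ 2) (surfaceArea S) :=
      hg.integrable_norm_pow (by norm_num)
    have hi2 := hD.integrable_inner_two hg
    have hi3 : Integrable (fun x : S => ‖G x - Gf x‖ ^ 2) (surfaceArea S) :=
      hD.integrable_norm_pow (by norm_num)
    have heq : ∫ x : S, ‖surfaceGradient S (φ n) x - (G x - Gf x)‖ ^ 2 ∂surfaceArea S
        = ∫ x : S, ‖surfaceGradient S (φ n) x‖ ^ 2 ∂surfaceArea S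
          - 2 * ∫ x : S, inner ℝ (G x - Gf x) (surfaceGradient S (φ n) x) ∂surfaceArea S
          + ∫ x : S, ‖G x - Gf x‖ ^ 2 ∂surfaceArea S := by
      have hi12 : Integrable (fun x : S => ‖surfaceGradient S (φ n) x‖ ^ 2
          - 2 * inner ℝ (G x - Gf x) (surfaceGradient S (φ n) x)) (surfaceArea S) :=
        hi1.sub (hi2.const_mul _)
      rw [← integral_const_mul, ← integral_sub hi1 (hi2.const_mul _), ← integral_add hi12 hi3]
      refine integral_congr_ae (Eventually.of_forall fun x => ?_)
      simp only [norm_sub_sq_real (surfaceGradient S (φ n) x)]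
      rw [real_inner_comm]
    have hnn : 0 ≤ ∫ x : S, ‖surfaceGradient S (φ n) x‖ ^ 2 ∂surfaceArea S :=
      integral_nonneg fun x => by positivity
    rw [heq, horth _ (hφ n)]
    linarith
  have h0 : eLpNorm (fun x => G x - Gf x) 2 (surfaceArea S) = 0 :=
    le_antisymm (ge_of_tendsto' hlim hle) zero_le
  rw [eLpNorm_eq_zero_iff hD.1 (by norm_num)] at h0
  filter_upwards [h0] with x hx using hx

/-- One-sided comparison of the solutions of two obstacle problems. -/
theorem obstacleMinimizer_sub_le [PreconnectedSpace S] [Nonempty S] (hH : Continuous H)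
    {f : S → ℝ} (hf : Continuous f) (hfH : HasSurfaceLaplacian S f H) {β₁ β₂ : ℝ}
    (hβ : β₁ < β₂) (hosc : ∀ a b, (∀ x, a ≤ f x) → (∀ x, f x ≤ b) → β₂ ≤ b - a)
    {V₁ V₂ : S → ℝ} {G₁ G₂ : S → Space} (hV₁ : IsObstacleMinimizer S H β₁ V₁ G₁)
    (hV₂ : IsObstacleMinimizer S H β₂ V₂ G₂) :
    ∀ᵐ x ∂surfaceArea S, V₂ x - V₁ x ≤ (β₂ - β₁) / 2 := by
  have hD := hS.hasSobolevGradient_posPart (hS.hasSobolevGradient_sub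
    (hS.hasSobolevGradient_sub hV₂.1.1 hV₁.1.1) (hS.hasSobolevGradient_const ((β₂ - β₁) / 2)))
  simp only [sub_zero] at hD
  set D : S → ℝ := fun x => max (V₂ x - V₁ x - (β₂ - β₁) / 2) 0 with hDdef
  set P : S → Space :=
    {x | 0 < V₂ x - V₁ x - (β₂ - β₁) / 2}.indicator fun x => G₂ x - G₁ x with hP
  have hW₁ : IsObstacleAdmissible S β₁ (fun x => V₁ x + D x) (fun x => G₁ x + P x) := by
    refine ⟨hS.hasSobolevGradient_add hV₁.1.1 hD, ?_⟩
    filter_upwards [hV₁.1.2, hV₂.1.2] with x h1 h2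
    simp only [hDdef]
    rw [abs_le] at *
    rcases max_cases (V₂ x - V₁ x - (β₂ - β₁) / 2) 0 with ⟨e, h⟩ | ⟨e, h⟩ <;> rw [e] <;>
      constructor <;> linarith
  have hW₂ : IsObstacleAdmissible S β₂ (fun x => V₂ x - D x) (fun x => G₂ x - P x) := by
    refine ⟨hS.hasSobolevGradient_sub hV₂.1.1 hD, ?_⟩
    filter_upwards [hV₁.1.2, hV₂.1.2] with x h1 h2
    simp only [hDdef]
    rw [abs_le] at *
    rcases max_cases (V₂ x - V₁ x - (β₂ - β₁) / 2) 0 with ⟨e, h⟩ | ⟨e, h⟩ <;> rw [e] <;>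
      constructor <;> linarith
  have hsum : obstacleEnergy S H (fun x => V₁ x + D x) (fun x => G₁ x + P x)
      + obstacleEnergy S H (fun x => V₂ x - D x) (fun x => G₂ x - P x)
      = obstacleEnergy S H V₁ G₁ + obstacleEnergy S H V₂ G₂ := by
    simp only [obstacleEnergy]
    rw [← integral_add (hS.integrable_energy hH hW₁.1) (hS.integrable_energy hH hW₂.1),
      ← integral_add (hS.integrable_energy hH hV₁.1.1) (hS.integrable_energy hH hV₂.1.1)]
    refine integral_congr_ae (Eventually.of_forall fun x => ?_)
    by_cases hx : 0 < V₂ x - V₁ x - (β₂ - β₁) / 2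
    · have : P x = G₂ x - G₁ x :=
        indicator_of_mem (s := {x | 0 < V₂ x - V₁ x - (β₂ - β₁) / 2}) hx _
      simp only [this, add_sub_cancel, sub_sub_cancel]
      ring
    · have : P x = 0 :=
        indicator_of_notMem (s := {x | 0 < V₂ x - V₁ x - (β₂ - β₁) / 2}) hx _
      simp only [this, add_zero, sub_zero]
      ring
  -- The total energy is unchanged, and V₂ - D cannot lie below V₂, so V₁ + D cannot lie above V₁.
  have hle : obstacleEnergy S H (fun x => V₁ x + D x) (fun x => G₁ x + P x)
      ≤ obstacleEnergy S H V₁ G₁ := by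
    linarith [hV₂.2 _ _ hW₂]
  have hP0 := hS.gradient_ae_eq_of_energy_le hH hV₁ hW₁ hle
  simp only [add_sub_cancel_left] at hP0
  obtain ⟨k, hk⟩ := hS.exists_ae_eq_const (hD.congr (ae_eq_refl _) hP0)
  rcases le_or_gt k 0 with hk0 | hk0
  · filter_upwards [hk] with x hx
    have := le_max_left (V₂ x - V₁ x - (β₂ - β₁) / 2) 0
    linarith
  exfalso
  obtain ⟨Gf, hGf, hweak⟩ := hfH
  have hVk : ∀ᵐ x ∂surfaceArea S, V₁ x + k ≤ β₁ / 2 := by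
    filter_upwards [hk, hW₁.2] with x h1 h2
    rw [← h1]
    exact (abs_le.1 h2).2
  -- Now V₁ - f is a constant `m`, which confines f to an interval of length β₁ - k < β₂.
  have hG := hS.gradient_ae_eq_of_interior hH hGf hweak hV₁ hk0 hVk
  obtain ⟨m, hm⟩ := hS.exists_ae_eq_const
    ((hS.hasSobolevGradient_sub hV₁.1.1 hGf).congr (ae_eq_refl _) hG)
  have ha : ∀ᵐ x ∂surfaceArea S, -(β₁ / 2) - m ≤ f x := by
    filter_upwards [hm, hV₁.1.2] with x h1 h2
    linarith [(abs_le.1 h2).1]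
  have hb : ∀ᵐ x ∂surfaceArea S, f x ≤ β₁ / 2 - k - m := by
    filter_upwards [hm, hVk] with x h1 h2
    linarith
  have := hosc _ _ (hS.forall_le_of_ae_le continuous_const hf ha)
    (hS.forall_le_of_ae_le hf continuous_const hb)
  linarith

end IsRegularSurface

/-! ### The inclusion of the regions and the conclusion. -/

/-- The allowed difference of the solutions is exactly the difference of the thresholds, so a strict
gap below β₁/2 becomes the same gap below β₂/2. -/
theorem superconductivityRegion_subset {S : Set Space} {β₁ β₂ : ℝ} {V₁ V₂ : S → ℝ}
    (h : ∀ᵐ x ∂surfaceArea S, |V₁ x - V₂ x| ≤ (β₂ - β₁) / 2) :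
    superconductivityRegion S β₁ V₁ ⊆ superconductivityRegion S β₂ V₂ := by
  rintro x ⟨c, hc, O, hO, hx, hae⟩
  refine ⟨c + (β₂ - β₁) / 2, by linarith, O, hO, hx, ?_⟩
  filter_upwards [h, hae] with y h1 h2 hy
  have h3 := abs_sub_abs_le_abs_sub (V₂ y) (V₁ y)
  rw [abs_sub_comm] at h3
  linarith [h2 hy]

theorem proposition2p3 (S : Set (EuclideanSpace ℝ (Fin 3))) (hS : IsRegularSurface S)
    (hsphere : Nonempty (S ≃ₜ Metric.sphere (0 : EuclideanSpace ℝ (Fin 3)) 1))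
    (H f : S → ℝ) (hH : IsSurfaceC1 S H)
    (hf : Continuous f) (hfH : HasSurfaceLaplacian S f H)
    (β₁ β₂ : ℝ) (hβ₁ : 0 < β₁) (hβ : β₁ < β₂)
    (hβc : β₂ ≤ (⨆ x, f x) - (⨅ x, f x))
    (V₁ V₂ : S → ℝ) (hV₁ : IsObstacleSolution S H β₁ V₁) (hV₂ : IsObstacleSolution S H β₂ V₂) :
    superconductivityRegion S β₁ V₁ ⊆ superconductivityRegion S β₂ V₂ ∧
      ∀ᵐ x ∂(surfaceArea S), |V₁ x - V₂ x| ≤ (β₂ - β₁) / 2 := by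
  -- The sphere provides only compactness, connectedness and nonemptiness.
  obtain ⟨e⟩ := hsphere
  have hcpt : CompactSpace S := e.symm.compactSpace
  have hconn : ConnectedSpace (Metric.sphere (0 : EuclideanSpace ℝ (Fin 3)) 1) := by
    refine isConnected_iff_connectedSpace.1 (isConnected_sphere ?_ 0 zero_le_one)
    rw [← Module.finrank_eq_rank, finrank_euclideanSpace_fin]
    norm_num
  have hconn' : PreconnectedSpace S :=
    e.symm.surjective.denseRange.preconnectedSpace e.symm.continuous
  have hne : Nonempty S := hconn.toNonempty.map e.symm
  obtain ⟨G₁, hG₁⟩ := hV₁.exists_isObstacleMinimizer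
  obtain ⟨G₂, hG₂⟩ := hV₂.exists_isObstacleMinimizer
  have hosc : ∀ a b, (∀ x, a ≤ f x) → (∀ x, f x ≤ b) → β₂ ≤ b - a := fun a b ha hb => by
    have h1 : (⨆ x, f x) ≤ b := ciSup_le hb
    have h2 : a ≤ ⨅ x, f x := le_ciInf ha
    linarith
  have h1 := hS.obstacleMinimizer_sub_le hH.continuous hf hfH hβ hosc hG₁ hG₂
  -- The reverse inequality comes from the problem with all signs changed; the oscillation of f is
  -- unaffected.
  have h2 := hS.obstacleMinimizer_sub_le hH.continuous.neg hf.neg hfH.neg hβ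
    (fun a b ha hb => by
      have := hosc (-b) (-a) (fun x => neg_le.1 (hb x)) (fun x => le_neg.1 (ha x))
      linarith) hG₁.neg hG₂.neg
  have h3 : ∀ᵐ x ∂(surfaceArea S), |V₁ x - V₂ x| ≤ (β₂ - β₁) / 2 := by
    filter_upwards [h1, h2] with x hx1 hx2
    simp only [Pi.neg_apply] at hx2
    rw [abs_le]
    constructor <;> linarith
  exact ⟨superconductivityRegion_subset h3, h3⟩
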